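/- \textbf{De-biased weighted graphical Lasso, regime $p\gg n$.} For every $n$ let $X^1,\dots,X^n$ be independent observations with a common distribution on $\mathbb R^{p}$, $p=p_n\ge 2$, with mean zero and covariance matrix $\Sigma_0$ (both $p$ and the distribution may depend on $n$). Let $\hat\Sigma:=\frac1n\sum_{k=1}^n X^k(X^k)^T$. Let $L\ge 1$ and $K>0$ be constants not depending on $n$ and assume: (i) (bounded spectrum) $\Theta_0:=\Sigma_0^{-1}$ exists and $1/L\le\Lambda_{\min}(\Theta_0)\le\Lambda_{\max}(\Theta_0)\le L$; (ii) (sub-Gaussianity) $\mathbb E\exp(|\alpha^TX^k|^2/K^2)\le 2$ for every $k$ and every $\alpha\in\mathbb R^p$ with $\|\alpha\|_2=1$. Let $\Theta^0_{ij}$ and $\Theta^0_j$ denote the entries and the columns of $\Theta_0$, $d_j:=\#\{i\neq j:\Theta^0_{ij}\ne 0\}$, $d:=\max_j d_j\vee 1$ and $s:=\left(\sum_{j=1}^p d_j\right)\vee 1$ (the maxima with $1$ matter only if $\Theta_0$ is diagonal), and let $\underline d:=\max_j d_j$. For $\lambda>0$ the weighted graphical Lasso is $$\hat\Theta_{\mathrm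 w}=\operatorname*{argmin}_{\Theta=\Theta^T,\ \Theta\succ 0}\ \operatorname{tr}(\hat\Sigma\Theta)-\log\det\Theta+\lambda\sum_{i\neq j}\hat W_{ii}\hat W_{jj}|\Theta_{ij}|,\qquad \hat W^2=\operatorname{diag}(\hat\Sigma),$$ with an arbitrary (measurable) value where the minimizer does not exist. Put $\|A\|_\infty:=\max_{i,j}|A_{ij}|$ and $\sigma_{ij}^2:=n\operatorname{var}\big((\Theta^0_i)^T\hat\Sigma\,\Theta^0_j\big)$. There is a constant $c_0>0$ depending only on $L$ and $K$ such that the following holds as $n\to\infty$ whenever (i), (ii) and $$s\sqrt{d}=o\!\left(\frac{\sqrt n}{\log p}\right)$$ hold and the (deterministic) tuning parameters satisfy $\lambda\asymp\sqrt{\log p/n}$ with $\lambda\ge c_0\sqrt{\log p/n}$ for all large $n$. The minimizer $\hat\Theta_{\mathrm w}$ exists with probability tending to one, $$2\hat\Theta_{\mathrm w}-\hat\Theta_{\mathrm w}\hat\Sigma\hat\Theta_{\mathrm w}-\Theta_0=-\Theta_0(\hat\Sigma-\Sigma_0)\Theta_0+\mathrm{rem},$$ where $$\|\mathrm{rem}\|_\infty=\mathcal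 O_P\!\left(12(8L^2)^2\,s\sqrt{\underline d+1}\,\lambda^2\right)\quad\text{and}\quad \|\mathrm{rem}\|_\infty=o_P(1/\sqrt n).$$ Moreover, for all index sequences $(i,j)=(i_n,j_n)$ in $\{1,\dots,p_n\}^2$ for which $\sigma_{ij}$ stays bounded away from zero (for all large $n$), $$\sqrt n\,\big(2\hat\Theta_{\mathrm w}-\hat\Theta_{\mathrm w}\hat\Sigma\hat\Theta_{\mathrm w}-\Theta_0\big)_{ij}/\sigma_{ij}\ \rightsquigarrow\ \mathcal N(0,1).$$ -/

import Mathlib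

open MeasureTheory ProbabilityTheory Filter Matrix
open scoped Topology

noncomputable section

namespace WGlasso

/-- The covariance matrix of a distribution `μ` on `ℝ^p`. -/
def covMat {p : ℕ} (μ : Measure (Fin p → ℝ)) : Matrix (Fin p) (Fin p) ℝ :=
  Matrix.of fun i j => cov[fun x => x i, fun x => x j; μ]

/-- The precision matrix, i.e. the inverse of the covariance matrix. -/
def precMat {p : ℕ} (μ : Measure (Fin p → ℝ)) : Matrix (Fin p) (Fin p) ℝ :=
  (covMat μ)⁻¹

/-- Bounded spectrum: the precision matrix exists and its eigenvalues lie in `[1/L, L]`. -/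
def BoundedSpectrum {p : ℕ} (μ : Measure (Fin p → ℝ)) (L : ℝ) : Prop :=
  IsUnit (covMat μ).det ∧ ∀ t ∈ spectrum ℝ (precMat μ), 1 / L ≤ t ∧ t ≤ L

/-- Sub-Gaussianity with constant `K`: `E exp (|αᵀ X|² / K²) ≤ 2` for every unit vector `α`. The
expectation is the `[0, ∞]`-valued integral, so that its finiteness is part of the claim. -/
def SubGaussian {p : ℕ} (μ : Measure (Fin p → ℝ)) (K : ℝ) : Prop :=
  ∀ α : Fin p → ℝ, ∑ i, α i ^ 2 = 1 →
    ∫⁻ x, ENNReal.ofReal (Real.exp (|∑ i, α i * x i| ^ 2 / K ^ 2)) ∂μ ≤ 2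

/-- The degree `d_j = #{i ≠ j : Θ_ij ≠ 0}` of the node `j`. -/
def nodeDegree {p : ℕ} (Θ : Matrix (Fin p) (Fin p) ℝ) (j : Fin p) : ℕ :=
  {i : Fin p | Θ i j ≠ 0 ∧ i ≠ j}.ncard

/-- The maximal degree `d = max_j d_j`. -/
def maxDegree {p : ℕ} (Θ : Matrix (Fin p) (Fin p) ℝ) : ℕ :=
  Finset.univ.sup (nodeDegree Θ)

/-- The number `s = ∑_j d_j` of non-zero off-diagonal entries. -/
def sparsity {p : ℕ} (Θ : Matrix (Fin p) (Fin p) ℝ) : ℕ :=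
  ∑ j, nodeDegree Θ j

/-- The sample covariance matrix `XᵀX / n` of the observations `x 0, …, x (n-1)`. -/
def sampleCov {n p : ℕ} (x : Fin n → Fin p → ℝ) : Matrix (Fin p) (Fin p) ℝ :=
  Matrix.of fun i j => (∑ k, x k i * x k j) / n

/-- The objective function of the weighted graphical Lasso, as a function of `Θ`:
`tr(SΘ) - log det Θ + lam * ∑_{i ≠ j} W_ii W_jj |Θ_ij|` with `W² = diag S`. -/
def objective {p : ℕ} (S : Matrix (Fin p) (Fin p) ℝ) (lam : ℝ)
    (Θ : Matrix (Fin p) (Fin p) ℝ) : ℝ :=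
  (S * Θ).trace - Real.log Θ.det
    + lam * ∑ i, ∑ j, if i = j then 0 else √(S i i) * √(S j j) * |Θ i j|

/-- `Θ` is a weighted graphical Lasso: it minimizes the objective over all symmetric positive
definite matrices. -/
def IsWeightedGlasso {p : ℕ} (S : Matrix (Fin p) (Fin p) ℝ) (lam : ℝ)
    (Θ : Matrix (Fin p) (Fin p) ℝ) : Prop :=
  Θ.PosDef ∧ IsMinOn (objective S lam) {Θ' | Θ'.PosDef} Θ

/-- The de-biased estimator `2Θ - ΘSΘ`. -/
def debiased {p : ℕ} (S Θ : Matrix (Fin p) (Fin p) ℝ) : Matrix (Fin p) (Fin p) ℝ :=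
  (2 : ℝ) • Θ - Θ * S * Θ

/-- The entrywise supremum norm of a matrix. -/
def supNorm {p : ℕ} (A : Matrix (Fin p) (Fin p) ℝ) : ℝ :=
  ⨆ ij : Fin p × Fin p, |A ij.1 ij.2|

/-- `Y n = O_P(r n)`. -/
def IsBigOP {Ω : ℕ → Type*} [∀ n, MeasurableSpace (Ω n)] (P : (n : ℕ) → Measure (Ω n))
    (Y : (n : ℕ) → Ω n → ℝ) (r : ℕ → ℝ) : Prop :=
  ∀ ε : ℝ, 0 < ε → ∃ M : ℝ, ∀ᶠ n in atTop, P n {ω | M * r n < |Y n ω|} ≤ ENNReal.ofReal ε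

/-- `Y n = o_P(r n)`. -/
def IsLittleOP {Ω : ℕ → Type*} [∀ n, MeasurableSpace (Ω n)] (P : (n : ℕ) → Measure (Ω n))
    (Y : (n : ℕ) → Ω n → ℝ) (r : ℕ → ℝ) : Prop :=
  ∀ ε : ℝ, 0 < ε → Tendsto (fun n => P n {ω | ε * r n < |Y n ω|}) atTop (𝓝 0)

/-- The asymptotic standard deviation `σ_ij`, where `σ_ij² = n var((Θ⁰_i)ᵀ Σ̂ Θ⁰_j)` and `Θ⁰_i` is
the `i`-th column of the precision matrix `Θ⁰` of `μ`. -/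
def asympSD {n p : ℕ} {Ω : Type*} [MeasurableSpace Ω] (P : Measure Ω) (μ : Measure (Fin p → ℝ))
    (X : Fin n → Ω → Fin p → ℝ) (i j : Fin p) : ℝ :=
  √(n * Var[fun ω => (fun a => precMat μ a i) ⬝ᵥ
    (sampleCov (fun k => X k ω) *ᵥ fun a => precMat μ a j); P])

end WGlasso

end

/-! Write `C` for the true covariance, `Θ` for its inverse, `S` for the sample covariance and `D`
for the error of the minimizer. Because `C` and `Θ` are inverse to each other, the terms linear in
`D` alone cancel in the de-biased estimator, and the remainder is `-D(S-C)Θ - Θ(S-C)D - DCD -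
D(S-C)D` (`debiased_sub_eq`). Each summand is of second order. Columns of `Θ` have ℓ¹ norm at most
`L√(d+1)`, entries of `S - C` are of order `√(log p / n)`, columns of `D` have ℓ¹ norm of order `sλ`
and squared ℓ² norm of order `sλ²`. This gives the rate `s√(d+1)λ²`, which the sparsity assumption
makes `o(1/√n)`.

The bounds on `D` come from a rescaling. Conjugation by the sample standard deviations turns the
weighted problem into the ordinary graphical Lasso fed with the sample correlation matrix
(`objective_eq_normalized`). Its diagonal agrees exactly with that of the true correlation matrix,
so the noise lives off the diagonal and only `s`, not `s + p`, enters the oracle inequality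
`glasso_oracle`. The curvature of `-log det` is used in the global form `exists_frobSq_sub_le`,
quadratic near the truth and linear far away, so the minimizer needs neither prior localization nor
uniqueness. Existence also holds for singular `S`: the penalty outweighs the off-diagonal part of
`tr(SΘ)`, which makes the objective coercive (`objective_ge`).

For the noise, products of coordinates are sub-exponential, and Bernstein's inequality with a union
bound over `p²` entries lets the penalty dominate outside an event of probability `2/p`. Since `p`
need not tend to infinity, `exists_good_event` treats bounded dimensions separately: there a higher
noise level is allowed and sparsity is not exploited, at the price of a constant.

Finally, an entry of the linear term is an average of i.i.d. centred sub-exponential variables.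
Their third moments stay bounded after division by `σ`, which is bounded below, so
`tendstoInDistribution_triangular` applies and absorbs the remainder. -/

noncomputable section

namespace WGlasso

/-! ### Frobenius norm, curvature of the log-determinant, positive semidefinite matrices -/

section MatrixAlgebra

variable {ι : Type*} [Fintype ι]

/-- The squared Frobenius norm. -/
def frobSq (A : Matrix ι ι ℝ) : ℝ := ∑ i, ∑ j, A i j ^ 2

lemma frobSq_nonneg (A : Matrix ι ι ℝ) : 0 ≤ frobSq A :=
  Finset.sum_nonneg fun _ _ => Finset.sum_nonneg fun _ _ => sq_nonneg _

lemma frobSq_eq_trace (A : Matrix ι ι ℝ) : frobSq A = (A * Aᵀ).trace := by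
  simp [frobSq, Matrix.trace, Matrix.mul_apply, sq]

variable [DecidableEq ι]

lemma frobSq_orthogonal_conj {U : Matrix ι ι ℝ} (h : Uᵀ * U = 1) (A : Matrix ι ι ℝ) :
    frobSq (U * A * Uᵀ) = frobSq A := by
  rw [frobSq_eq_trace, frobSq_eq_trace]
  have : U * A * Uᵀ * (U * A * Uᵀ)ᵀ = U * (A * Aᵀ * Uᵀ) := by
    simp only [transpose_mul, transpose_transpose]
    calc _ = U * A * (Uᵀ * U) * (Aᵀ * Uᵀ) := by simp only [Matrix.mul_assoc]
      _ = _ := by rw [h]; simp only [Matrix.mul_assoc, Matrix.mul_one]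
  rw [this, Matrix.trace_mul_comm, Matrix.mul_assoc, h, Matrix.mul_one]

lemma frobSq_diagonal (d : ι → ℝ) : frobSq (diagonal d) = ∑ i, d i ^ 2 := by
  refine Finset.sum_congr rfl fun i _ => ?_
  rw [Finset.sum_eq_single i] <;> simp +contextual [eq_comm]

lemma exists_orthogonal_diagonalization {A : Matrix ι ι ℝ} (hA : A.IsHermitian) :
    ∃ U : Matrix ι ι ℝ, Uᵀ * U = 1 ∧ U * Uᵀ = 1 ∧ A = U * diagonal hA.eigenvalues * Uᵀ := by
  refine ⟨hA.eigenvectorUnitary, ?_, ?_, ?_⟩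
  · simpa [star_eq_conjTranspose, conjTranspose_eq_transpose_of_trivial] using
      Unitary.coe_star_mul_self hA.eigenvectorUnitary
  · simpa [star_eq_conjTranspose, conjTranspose_eq_transpose_of_trivial] using
      Unitary.coe_mul_star_self hA.eigenvectorUnitary
  · have := hA.spectral_theorem
    rw [Unitary.conjStarAlgAut_apply] at this
    simpa [star_eq_conjTranspose, conjTranspose_eq_transpose_of_trivial,
      Function.comp_def] using this

/-- With `y = √(1 + u)`, the bound `log y ≤ y - 1` leaves `(y - 1)²` on the right, while `u = (y -
1)(y + 1)` and `(y + 1)² ≤ 2(y² + 1) ≤ 4(1 + x)`. The separate `x ≥ |u|` gives all eigenvalues a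
common denominator, so that the bound can be summed. -/
lemma sq_div_le_sub_log {u x : ℝ} (hu : -1 < u) (hx : |u| ≤ x) :
    u ^ 2 / (4 * (1 + x)) ≤ u - Real.log (1 + u) := by
  set y := √(1 + u)
  have hy : 0 < y := Real.sqrt_pos.2 (by linarith)
  have hy2 : y ^ 2 = 1 + u := Real.sq_sqrt (by linarith)
  have hlog : Real.log (1 + u) ≤ 2 * (y - 1) := by
    rw [← hy2, Real.log_pow]
    have := Real.log_le_sub_one_of_pos hy
    push_cast
    linarith
  have h1 : (y - 1) ^ 2 ≤ u - Real.log (1 + u) := by nlinarith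
  have h0 : 0 ≤ x := (abs_nonneg u).trans hx
  refine le_trans ?_ h1
  rw [div_le_iff₀ (by positivity)]
  have h2 : u ^ 2 = (y - 1) ^ 2 * (y + 1) ^ 2 := by
    have : u = (y - 1) * (y + 1) := by nlinarith
    rw [this]; ring
  rw [h2]
  refine mul_le_mul_of_nonneg_left ?_ (sq_nonneg _)
  have := le_abs_self u
  nlinarith [sq_nonneg (y - 1)]

/-- Strong convexity of `-log det`, in a global form. -/
lemma exists_frobSq_sub_le {A B : Matrix ι ι ℝ} (hA : A.PosDef) (hB : B.PosDef) {c : ℝ}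
    (hc : ∀ i, hA.1.eigenvalues i ≤ c) :
    ∃ x : ℝ, 0 ≤ x ∧ frobSq (B - A) ≤ (c * x) ^ 2 ∧
      x ^ 2 / (4 * (1 + x)) ≤
        (A⁻¹ * (B - A)).trace - (Real.log B.det - Real.log A.det) := by
  obtain ⟨U, hU1, hU2, hUA⟩ := exists_orthogonal_diagonalization hA.1
  set a := hA.1.eigenvalues
  have ha : ∀ i, 0 < a i := hA.eigenvalues_pos
  -- `C` whitens `A`, that is `C A Cᵀ = 1`, and `G` is its inverse. In these coordinates the
  -- divergence depends only on the eigenvalues `ν` of `N = C B Cᵀ`: it is the sum of `ν - 1 - log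
  -- ν`.
  set C : Matrix ι ι ℝ := diagonal (fun i => (√(a i))⁻¹) * Uᵀ with hC
  set G : Matrix ι ι ℝ := U * diagonal (fun i => √(a i)) with hG
  have hGC : G * C = 1 := by
    rw [hC, hG]
    calc _ = U * (diagonal (fun i => √(a i)) * diagonal (fun i => (√(a i))⁻¹)) * Uᵀ := by
          simp only [Matrix.mul_assoc]
      _ = 1 := by
          rw [diagonal_mul_diagonal]
          have : (fun i => √(a i) * (√(a i))⁻¹) = fun _ => 1 := by
            funext i; exact mul_inv_cancel₀ (Real.sqrt_pos.2 (ha i)).ne'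
          rw [this, diagonal_one, Matrix.mul_one, hU2]
  have hCG : C * G = 1 := mul_eq_one_comm.1 hGC
  have hAG : A = G * Gᵀ := by
    rw [hUA, hG, transpose_mul, diagonal_transpose]
    calc _ = U * (diagonal (fun i => √(a i)) * diagonal (fun i => √(a i))) * Uᵀ := by
          rw [diagonal_mul_diagonal]
          simp only [Real.mul_self_sqrt (ha _).le]
      _ = _ := by simp only [Matrix.mul_assoc]
  have hGCt : Cᵀ * Gᵀ = 1 := by rw [← transpose_mul, hGC, transpose_one]
  have hCGt : Gᵀ * Cᵀ = 1 := by rw [← transpose_mul, hCG, transpose_one]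
  have hAinv : A⁻¹ = Cᵀ * C := by
    refine inv_eq_right_inv ?_
    calc A * (Cᵀ * C) = G * (Gᵀ * Cᵀ) * C := by rw [hAG]; simp only [Matrix.mul_assoc]
      _ = 1 := by rw [hCGt, Matrix.mul_one, hGC]
  set N : Matrix ι ι ℝ := C * B * Cᵀ with hN
  have hCAC : C * A * Cᵀ = 1 := by
    calc _ = (C * G) * (Gᵀ * Cᵀ) := by rw [hAG]; simp only [Matrix.mul_assoc]
      _ = 1 := by rw [hCG, hCGt, Matrix.mul_one]
  have hNpos : N.PosDef := by
    have hu : IsUnit C := IsUnit.of_mul_eq_one _ hCG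
    have := (Matrix.IsUnit.posDef_star_right_conjugate_iff (x := B) hu).2 hB
    simpa [star_eq_conjTranspose, conjTranspose_eq_transpose_of_trivial] using this
  have hBA : B - A = U * (diagonal (fun i => √(a i)) * (N - 1) *
      diagonal (fun i => √(a i))) * Uᵀ := by
    have h1 : G * (N - 1) * Gᵀ = B - A := by
      rw [Matrix.mul_sub, Matrix.sub_mul, Matrix.mul_one, ← hAG]
      congr 1
      calc _ = (G * C) * B * (Cᵀ * Gᵀ) := by rw [hN]; simp only [Matrix.mul_assoc]
        _ = B := by rw [hGC, hGCt, Matrix.one_mul, Matrix.mul_one]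
    rw [← h1, hG, transpose_mul, diagonal_transpose]
    simp only [Matrix.mul_assoc]
  have hc0 : ∀ i, 0 ≤ c := fun i => (ha i).le.trans (hc i)
  have hfrob : frobSq (B - A) ≤ c ^ 2 * frobSq (N - 1) := by
    rw [hBA, frobSq_orthogonal_conj hU1]
    unfold frobSq
    rw [Finset.mul_sum]
    refine Finset.sum_le_sum fun i _ => ?_
    rw [Finset.mul_sum]
    refine Finset.sum_le_sum fun j _ => ?_
    rw [mul_diagonal, diagonal_mul]
    have : (√(a i) * (N - 1) i j * √(a j)) ^ 2 = a i * a j * (N - 1) i j ^ 2 := by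
      rw [mul_pow, mul_pow, Real.sq_sqrt (ha i).le, Real.sq_sqrt (ha j).le]; ring
    rw [this]
    refine mul_le_mul_of_nonneg_right ?_ (sq_nonneg _)
    rw [sq]
    exact mul_le_mul (hc i) (hc j) (ha j).le (hc0 i)
  set ν := hNpos.1.eigenvalues
  have hν : ∀ i, 0 < ν i := hNpos.eigenvalues_pos
  have hN1 : frobSq (N - 1) = ∑ i, (ν i - 1) ^ 2 := by
    obtain ⟨V, hV1, hV2, hVN⟩ := exists_orthogonal_diagonalization hNpos.1
    have : N - 1 = V * diagonal (fun i => ν i - 1) * Vᵀ := by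
      have h : diagonal (fun i => ν i - 1) = diagonal ν - 1 := by
        rw [← diagonal_one, diagonal_sub]
      rw [h, Matrix.mul_sub, Matrix.sub_mul, Matrix.mul_one, hV2, ← hVN]
    rw [this, frobSq_orthogonal_conj hV1, frobSq_diagonal]
  -- The Frobenius norm of `N - 1` dominates every `|ν i - 1|`, as the scalar inequality requires.
  refine ⟨√(frobSq (N - 1)), Real.sqrt_nonneg _, ?_, ?_⟩
  · rw [mul_pow, Real.sq_sqrt (frobSq_nonneg _)]; exact hfrob
  have htr : (A⁻¹ * (B - A)).trace = ∑ i, (ν i - 1) := by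
    have h1 : (A⁻¹ * B).trace = ∑ i, ν i := by
      rw [hAinv, Matrix.mul_assoc, Matrix.trace_mul_comm]
      have := hNpos.1.trace_eq_sum_eigenvalues
      simpa using this
    have h2 : (A⁻¹ * A).trace = ∑ i : ι, (1 : ℝ) := by
      rw [Matrix.nonsing_inv_mul _ hA.det_pos.ne'.isUnit]; simp
    rw [Matrix.mul_sub, Matrix.trace_sub, h1, h2, Finset.sum_sub_distrib]
  have hdet : Real.log B.det - Real.log A.det = ∑ i, Real.log (ν i) := by
    have h1 : N.det = ∏ i, ν i := by simpa using hNpos.1.det_eq_prod_eigenvalues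
    have h2 : N.det * A.det = B.det := by
      have e : (C * A * Cᵀ).det = 1 := by rw [hCAC, det_one]
      rw [det_mul, det_mul] at e
      rw [hN, det_mul, det_mul]
      calc _ = B.det * (C.det * A.det * Cᵀ.det) := by ring
        _ = _ := by rw [e, mul_one]
    rw [← Real.log_prod (fun i _ => (hν i).ne'), ← h1, ← h2,
      Real.log_mul hNpos.det_pos.ne' hA.det_pos.ne']
    ring
  rw [htr, hdet, ← Finset.sum_sub_distrib]
  nth_rewrite 1 [Real.sq_sqrt (frobSq_nonneg _)]
  nth_rewrite 1 [hN1]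
  rw [Finset.sum_div]
  refine Finset.sum_le_sum fun i _ => ?_
  have := sq_div_le_sub_log (u := ν i - 1) (x := √(frobSq (N - 1))) (by linarith [hν i]) ?_
  · simpa using this
  · apply Real.abs_le_sqrt
    rw [hN1]
    exact Finset.single_le_sum (f := fun i => (ν i - 1) ^ 2) (fun _ _ => sq_nonneg _)
      (Finset.mem_univ i)

/-- Sum `log (e ν) ≤ e ν - 1` over the eigenvalues. The free slope `e` allows `log det` to be
absorbed by an arbitrarily small multiple of the trace. -/
lemma log_det_le {Θ : Matrix ι ι ℝ} (hΘ : Θ.PosDef) {e : ℝ} (he : 0 < e) :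
    Real.log Θ.det ≤ e * Θ.trace - Fintype.card ι * (1 + Real.log e) := by
  have hν : ∀ i, 0 < hΘ.1.eigenvalues i := hΘ.eigenvalues_pos
  have h1 : Θ.det = ∏ i, hΘ.1.eigenvalues i := by simpa using hΘ.1.det_eq_prod_eigenvalues
  have h2 : Θ.trace = ∑ i, hΘ.1.eigenvalues i := by simpa using hΘ.1.trace_eq_sum_eigenvalues
  rw [h1, h2, Real.log_prod (fun i _ => (hν i).ne'), Finset.mul_sum]
  have : (Fintype.card ι : ℝ) * (1 + Real.log e) = ∑ i : ι, (1 + Real.log e) := by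
    rw [Finset.sum_const, Finset.card_univ, nsmul_eq_mul]
  rw [this, ← Finset.sum_sub_distrib]
  refine Finset.sum_le_sum fun i _ => ?_
  have := Real.log_le_sub_one_of_pos (mul_pos he (hν i))
  rw [Real.log_mul he.ne' (hν i).ne'] at this
  linarith

lemma PosSemidef.exists_eq_transpose_mul {S : Matrix ι ι ℝ} (hS : S.PosSemidef) :
    ∃ B : Matrix ι ι ℝ, S = Bᵀ * B := by
  obtain ⟨U, -, -, h⟩ := exists_orthogonal_diagonalization hS.1
  refine ⟨diagonal (fun i => √(hS.1.eigenvalues i)) * Uᵀ, ?_⟩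
  rw [transpose_mul, diagonal_transpose, transpose_transpose]
  nth_rewrite 1 [h]
  calc _ = U * (diagonal (fun i => √(hS.1.eigenvalues i)) *
        diagonal (fun i => √(hS.1.eigenvalues i))) * Uᵀ := by
        rw [diagonal_mul_diagonal]
        simp only [Real.mul_self_sqrt (hS.eigenvalues_nonneg _)]
    _ = _ := by simp only [Matrix.mul_assoc]

lemma PosSemidef.abs_apply_le {S : Matrix ι ι ℝ} (hS : S.PosSemidef) (i j : ι) :
    |S i j| ≤ √(S i i) * √(S j j) := by
  obtain ⟨B, rfl⟩ := PosSemidef.exists_eq_transpose_mul hS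
  have hd : ∀ i, (Bᵀ * B) i i = ∑ k, B k i ^ 2 := fun i => by simp [Matrix.mul_apply, sq]
  rw [← Real.sqrt_mul (hS.diag_nonneg), hd, hd]
  apply Real.abs_le_sqrt
  simpa [Matrix.mul_apply] using Finset.sum_mul_sq_le_sq_mul_sq Finset.univ (B · i) (B · j)

lemma PosSemidef.trace_mul_nonneg {S T : Matrix ι ι ℝ} (hS : S.PosSemidef)
    (hT : T.PosSemidef) : 0 ≤ (S * T).trace := by
  obtain ⟨B, rfl⟩ := PosSemidef.exists_eq_transpose_mul hS
  rw [Matrix.mul_assoc, Matrix.trace_mul_comm]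
  have := (hT.mul_mul_conjTranspose_same B).trace_nonneg
  simpa [conjTranspose_eq_transpose_of_trivial] using this

end MatrixAlgebra

/-! ### Existence of the weighted graphical Lasso -/

section Existence

variable {p : ℕ}

lemma posDef_of_posSemidef_of_det_pos {Θ : Matrix (Fin p) (Fin p) ℝ} (h : Θ.PosSemidef)
    (hd : 0 < Θ.det) : Θ.PosDef := by
  rw [h.1.posDef_iff_eigenvalues_pos]
  intro i
  refine lt_of_le_of_ne (h.eigenvalues_nonneg i) fun h0 => ?_
  have h1 : Θ.det = ∏ i, h.1.eigenvalues i := by simpa using h.1.det_eq_prod_eigenvalues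
  rw [h1, Finset.prod_eq_zero (Finset.mem_univ i) h0.symm] at hd
  exact lt_irrefl _ hd

lemma isClosed_posSemidef : IsClosed {Θ : Matrix (Fin p) (Fin p) ℝ | Θ.PosSemidef} := by
  have : {Θ : Matrix (Fin p) (Fin p) ℝ | Θ.PosSemidef} =
      {Θ | Θᵀ = Θ} ∩ ⋂ x : Fin p → ℝ, {Θ | 0 ≤ x ⬝ᵥ (Θ *ᵥ x)} := by
    ext Θ
    simp only [Set.mem_ofPred_eq, Set.mem_inter_iff, Set.mem_iInter,
      posSemidef_iff_dotProduct_mulVec, IsHermitian, conjTranspose_eq_transpose_of_trivial,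
      star_trivial]
  rw [this]
  refine (isClosed_eq (by fun_prop) continuous_id).inter (isClosed_iInter fun x => ?_)
  exact isClosed_le continuous_const (by fun_prop)

/-- For semidefinite matrices the trace controls every entry, by `PosSemidef.abs_apply_le`. A
positive lower bound `l` on the determinant keeps the set inside the positive definite cone. -/
lemma isCompact_posSemidef_trace_le_le_det (u l : ℝ) :
    IsCompact {Θ : Matrix (Fin p) (Fin p) ℝ | Θ.PosSemidef ∧ Θ.trace ≤ u ∧ l ≤ Θ.det} := by
  have hK : IsCompact (Set.pi Set.univ fun _ : Fin p => Set.pi Set.univ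
      fun _ : Fin p => Set.Icc (-u) u) :=
    isCompact_univ_pi fun _ => isCompact_univ_pi fun _ => isCompact_Icc
  have hclosed : IsClosed
      {Θ : Matrix (Fin p) (Fin p) ℝ | Θ.PosSemidef ∧ Θ.trace ≤ u ∧ l ≤ Θ.det} := by
    refine isClosed_posSemidef.inter (IsClosed.inter ?_ ?_)
    · exact isClosed_le (Continuous.matrix_trace continuous_id) continuous_const
    · exact isClosed_le continuous_const (Continuous.matrix_det continuous_id)
  refine hK.of_isClosed_subset hclosed ?_
  rintro Θ ⟨hΘ, htr, -⟩ i - j -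
  have hle : ∀ i, Θ i i ≤ u := fun i => le_trans
    (Finset.single_le_sum (f := fun i => Θ i i) (fun _ _ => hΘ.diag_nonneg)
      (Finset.mem_univ i)) htr
  have hu : 0 ≤ u := hΘ.trace_nonneg.trans htr
  have := PosSemidef.abs_apply_le hΘ i j
  have h2 : √(Θ i i) * √(Θ j j) ≤ √u * √u := by
    gcongr <;> exact hle _
  rw [Real.mul_self_sqrt hu] at h2
  exact abs_le.1 (this.trans h2)

/-- Off the diagonal, `S i j * Θ i j` is at least `-√(S i i) √(S j j) |Θ i j|`, which the penalty
term compensates; only diagonal terms remain. Scaling by `t ≤ min 1 lam` adapts this to any penalty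
level. The resulting coercivity does not need `S` to be invertible. -/
lemma objective_ge {S : Matrix (Fin p) (Fin p) ℝ} (hS : S.PosSemidef) {lam t δ : ℝ}
    (ht : 0 ≤ t) (ht1 : t ≤ 1) (htl : t ≤ lam) (hδ : ∀ i, δ ≤ S i i)
    {Θ : Matrix (Fin p) (Fin p) ℝ} (hΘ : Θ.PosSemidef) :
    t * δ * Θ.trace - Real.log Θ.det ≤ objective S lam Θ := by
  unfold objective
  set Q := ∑ i, ∑ j, if i = j then 0 else √(S i i) * √(S j j) * |Θ i j| with hQ
  have hQ0 : 0 ≤ Q := Finset.sum_nonneg fun _ _ => Finset.sum_nonneg fun _ _ => by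
    split_ifs <;> positivity
  have hT0 : 0 ≤ (S * Θ).trace := PosSemidef.trace_mul_nonneg hS hΘ
  have key : δ * Θ.trace ≤ (S * Θ).trace + Q := by
    have h1 : (S * Θ).trace = ∑ i, ∑ j, S i j * Θ j i := by
      simp [Matrix.trace, Matrix.mul_apply]
    rw [h1, hQ, ← Finset.sum_add_distrib, Matrix.trace, Finset.mul_sum]
    refine Finset.sum_le_sum fun i _ => ?_
    rw [← Finset.sum_add_distrib]
    refine (mul_le_mul_of_nonneg_right (hδ i) (hΘ.diag_nonneg (i := i))).trans ?_
    have : S i i * Θ i i = S i i * Θ i i + if i = i then 0 else √(S i i) * √(S i i) * |Θ i i| := by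
      simp
    change S i i * Θ i i ≤ _
    rw [this]
    refine Finset.single_le_sum (f := fun j => S i j * Θ j i +
      if i = j then 0 else √(S i i) * √(S j j) * |Θ i j|) (fun j _ => ?_) (Finset.mem_univ i)
    split_ifs with hij
    · subst hij
      simpa using mul_nonneg (hS.diag_nonneg (i := i)) (hΘ.diag_nonneg (i := i))
    · have hs := PosSemidef.abs_apply_le hS i j
      have hsym : Θ j i = Θ i j := by
        have := congrFun (congrFun hΘ.1 i) j
        simpa [conjTranspose_eq_transpose_of_trivial] using this
      rw [hsym]
      have := neg_abs_le (S i j * Θ i j)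
      rw [abs_mul] at this
      nlinarith [mul_le_mul_of_nonneg_right hs (abs_nonneg (Θ i j))]
  nlinarith [mul_le_mul_of_nonneg_left key ht]

/-- The weighted graphical Lasso exists as soon as no sample variance vanishes. -/
lemma exists_isWeightedGlasso {S : Matrix (Fin p) (Fin p) ℝ} (hS : S.PosSemidef)
    (hd : ∀ i, 0 < S i i) {lam : ℝ} (hlam : 0 < lam) : ∃ Θ, IsWeightedGlasso S lam Θ := by
  obtain ⟨δ, hδ0, hδ⟩ : ∃ δ : ℝ, 0 < δ ∧ ∀ i, δ ≤ S i i := by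
    rcases isEmpty_or_nonempty (Fin p) with h | h
    · exact ⟨1, one_pos, fun i => h.elim i⟩
    · obtain ⟨i, hi⟩ := Finite.exists_min fun i => S i i
      exact ⟨S i i, hd i, hi⟩
  set t := min 1 lam
  have ht : 0 < t := lt_min one_pos hlam
  set a := t * δ with ha_def
  have ha : 0 < a := mul_pos ht hδ0
  have hlow : ∀ Θ : Matrix (Fin p) (Fin p) ℝ, Θ.PosDef →
      a * Θ.trace - Real.log Θ.det ≤ objective S lam Θ := fun Θ hΘ =>
    objective_ge hS ht.le (min_le_left _ _) (min_le_right _ _) hδ hΘ.posSemidef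
  -- The identity serves as reference point. On its sublevel set half of the coercive term `a *
  -- trace` absorbs `log det`, and the other half bounds the trace by `u`; the determinant is
  -- bounded below because the trace is nonnegative.
  set b := objective S lam 1
  set u := 2 / a * (b - Fintype.card (Fin p) * (1 + Real.log (a / 2))) with hu
  have hsub : ∀ Θ : Matrix (Fin p) (Fin p) ℝ, Θ.PosDef → objective S lam Θ ≤ b →
      Θ.trace ≤ u ∧ Real.exp (-b) ≤ Θ.det := by
    intro Θ hΘ hb
    have h1 := hlow Θ hΘ
    constructor
    · have h2 := log_det_le hΘ (half_pos ha)
      have : a / 2 * Θ.trace ≤ b - Fintype.card (Fin p) * (1 + Real.log (a / 2)) := by linarith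
      rw [hu, div_mul_eq_mul_div, le_div_iff₀ ha]
      linarith
    · rw [← Real.le_log_iff_exp_le hΘ.det_pos]
      have := mul_nonneg ha.le hΘ.posSemidef.trace_nonneg
      linarith
  set K := {Θ : Matrix (Fin p) (Fin p) ℝ | Θ.PosSemidef ∧ Θ.trace ≤ u ∧ Real.exp (-b) ≤ Θ.det}
  have hKc : IsCompact K := isCompact_posSemidef_trace_le_le_det _ _
  have h1K : (1 : Matrix (Fin p) (Fin p) ℝ) ∈ K := by
    have := hsub 1 PosDef.one le_rfl
    exact ⟨PosSemidef.one, this.1, this.2⟩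
  have hKpos : ∀ Θ ∈ K, Θ.PosDef := fun Θ hΘ =>
    posDef_of_posSemidef_of_det_pos hΘ.1 ((Real.exp_pos _).trans_le hΘ.2.2)
  have hcont : ContinuousOn (objective S lam) K := by
    unfold objective
    refine ContinuousOn.add (ContinuousOn.sub (by fun_prop) ?_) ?_
    · exact ContinuousOn.log (by fun_prop) fun Θ hΘ => (hKpos Θ hΘ).det_pos.ne'
    · refine Continuous.continuousOn (continuous_const.mul (continuous_finsetSum _ fun i _ =>
        continuous_finsetSum _ fun j _ => ?_))
      split_ifs
      · exact continuous_const
      · fun_prop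
  obtain ⟨Θ, hΘK, hΘ⟩ := hKc.exists_isMinOn ⟨1, h1K⟩ hcont
  refine ⟨Θ, hKpos Θ hΘK, fun Θ' hΘ' => ?_⟩
  by_cases hb : objective S lam Θ' ≤ b
  · have := hsub Θ' hΘ' hb
    exact hΘ ⟨hΘ'.posSemidef, this.1, this.2⟩
  · exact (hΘ h1K).trans (le_of_not_ge hb)

lemma sampleCov_posSemidef {n : ℕ} (x : Fin n → Fin p → ℝ) : (sampleCov x).PosSemidef := by
  have : sampleCov x = (n : ℝ)⁻¹ • ((Matrix.of x)ᴴ * Matrix.of x) := by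
    ext i j
    simp [sampleCov, Matrix.mul_apply, div_eq_inv_mul]
  rw [this]
  exact (posSemidef_conjTranspose_mul_self _).smul (by positivity)

end Existence

/-! ### Consequences of the bounded spectrum -/

section Spectral

variable {ι : Type*} [Fintype ι]

lemma abs_dotProduct_le (x y : ι → ℝ) : |x ⬝ᵥ y| ≤ √(x ⬝ᵥ x) * √(y ⬝ᵥ y) := by
  have h : ∀ x : ι → ℝ, x ⬝ᵥ x = ∑ i, x i ^ 2 := fun x => by simp [dotProduct, sq]
  rw [h, h, ← Real.sqrt_mul (Finset.sum_nonneg fun _ _ => sq_nonneg _)]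
  apply Real.abs_le_sqrt
  exact Finset.sum_mul_sq_le_sq_mul_sq _ _ _

variable [DecidableEq ι]

lemma orthogonal_mulVec_dotProduct {U : Matrix ι ι ℝ} (h : Uᵀ * U = 1) (x : ι → ℝ) :
    (U *ᵥ x) ⬝ᵥ (U *ᵥ x) = x ⬝ᵥ x := by
  rw [dotProduct_mulVec, ← mulVec_transpose, mulVec_mulVec, h, one_mulVec]

lemma dotProduct_mulVec_conj_diagonal (U : Matrix ι ι ℝ) (a : ι → ℝ) (x : ι → ℝ) :
    x ⬝ᵥ ((U * diagonal a * Uᵀ) *ᵥ x) = ∑ i, a i * (Uᵀ *ᵥ x) i ^ 2 := by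
  rw [← mulVec_mulVec, ← mulVec_mulVec, dotProduct_mulVec, ← mulVec_transpose]
  simp only [dotProduct, mulVec_diagonal]
  exact Finset.sum_congr rfl fun i _ => by ring

lemma quadForm_le {U : Matrix ι ι ℝ} (h : U * Uᵀ = 1) {a : ι → ℝ} {u : ℝ} (ha : ∀ i, a i ≤ u)
    (x : ι → ℝ) : x ⬝ᵥ ((U * diagonal a * Uᵀ) *ᵥ x) ≤ u * (x ⬝ᵥ x) := by
  rw [dotProduct_mulVec_conj_diagonal,
    ← orthogonal_mulVec_dotProduct (U := Uᵀ) (by rwa [transpose_transpose]) x, dotProduct,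
    Finset.mul_sum]
  refine Finset.sum_le_sum fun i _ => ?_
  rw [← sq]
  exact mul_le_mul_of_nonneg_right (ha i) (sq_nonneg _)

lemma le_quadForm {U : Matrix ι ι ℝ} (h : U * Uᵀ = 1) {a : ι → ℝ} {l : ℝ} (ha : ∀ i, l ≤ a i)
    (x : ι → ℝ) : l * (x ⬝ᵥ x) ≤ x ⬝ᵥ ((U * diagonal a * Uᵀ) *ᵥ x) := by
  rw [dotProduct_mulVec_conj_diagonal,
    ← orthogonal_mulVec_dotProduct (U := Uᵀ) (by rwa [transpose_transpose]) x, dotProduct,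
    Finset.mul_sum]
  refine Finset.sum_le_sum fun i _ => ?_
  rw [← sq]
  exact mul_le_mul_of_nonneg_right (ha i) (sq_nonneg _)

lemma mulVec_dotProduct_self_le {U : Matrix ι ι ℝ} (h1 : Uᵀ * U = 1) (h : U * Uᵀ = 1)
    {a : ι → ℝ} {u : ℝ} (ha : ∀ i, |a i| ≤ u) (x : ι → ℝ) :
    ((U * diagonal a * Uᵀ) *ᵥ x) ⬝ᵥ ((U * diagonal a * Uᵀ) *ᵥ x) ≤ u ^ 2 * (x ⬝ᵥ x) := by
  rw [← mulVec_mulVec, ← mulVec_mulVec, orthogonal_mulVec_dotProduct h1,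
    ← orthogonal_mulVec_dotProduct (U := Uᵀ) (by rwa [transpose_transpose]) x, dotProduct,
    dotProduct, Finset.mul_sum]
  refine Finset.sum_le_sum fun i _ => ?_
  rw [mulVec_diagonal]
  have : a i ^ 2 ≤ u ^ 2 := by
    rw [← sq_abs]; exact pow_le_pow_left₀ (abs_nonneg _) (ha i) 2
  nlinarith [mul_le_mul_of_nonneg_right this (sq_nonneg ((Uᵀ *ᵥ x) i))]

lemma eigenvalues_le_of_quadForm_le {A : Matrix ι ι ℝ} (hA : A.IsHermitian) {c : ℝ}
    (h : ∀ x : ι → ℝ, x ⬝ᵥ (A *ᵥ x) ≤ c * (x ⬝ᵥ x)) (i : ι) : hA.eigenvalues i ≤ c := by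
  have h1 := h (hA.eigenvectorBasis i)
  rw [hA.mulVec_eigenvectorBasis i] at h1
  have h2 : (⇑(hA.eigenvectorBasis i) : ι → ℝ) ⬝ᵥ ⇑(hA.eigenvectorBasis i) = 1 := by
    have := hA.eigenvectorBasis.orthonormal.1 i
    have h3 : ‖hA.eigenvectorBasis i‖ ^ 2 = 1 := by rw [this]; norm_num
    rw [EuclideanSpace.norm_sq_eq] at h3
    simpa [dotProduct, sq] using h3
  rw [dotProduct_smul, h2] at h1
  simpa using h1

/-- What is used of the assumption that `S` and `Θ` are inverse to each other, with spectra in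
`[1/L, L]`. -/
structure SpectralBounds (S Θ : Matrix ι ι ℝ) (L : ℝ) : Prop where
  posDef_cov : S.PosDef
  posDef : Θ.PosDef
  inv_eq : Θ⁻¹ = S
  diag_le : ∀ i, S i i ≤ L
  le_diag : ∀ i, 1 / L ≤ S i i
  bilin_le : ∀ x y : ι → ℝ, |x ⬝ᵥ (S *ᵥ y)| ≤ L * (√(x ⬝ᵥ x) * √(y ⬝ᵥ y))
  quad_le : ∀ x : ι → ℝ, x ⬝ᵥ (Θ *ᵥ x) ≤ L * (x ⬝ᵥ x)
  col_le : ∀ j, ∑ i, Θ i j ^ 2 ≤ L ^ 2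

/-- One orthogonal matrix diagonalizes both `S⁻¹` and `S`, and inversion preserves `[1/L, L]`.
Diagonal and column bounds come from evaluating the quadratic form and the norm at basis vectors. -/
lemma spectralBounds_of_spectrum {S : Matrix ι ι ℝ} (hS : S.IsHermitian) (hu : IsUnit S.det)
    {L : ℝ} (hL : 1 ≤ L) (hsp : ∀ t ∈ spectrum ℝ S⁻¹, 1 / L ≤ t ∧ t ≤ L) :
    SpectralBounds S S⁻¹ L := by
  have hL0 : 0 < L := one_pos.trans_le hL
  have hΘ : (S⁻¹).IsHermitian := hS.inv
  obtain ⟨U, hU1, hU2, hA⟩ := exists_orthogonal_diagonalization hΘ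
  set a := hΘ.eigenvalues
  have ha : ∀ i, 1 / L ≤ a i ∧ a i ≤ L := fun i => hsp _ (hΘ.eigenvalues_mem_spectrum_real i)
  have ha0 : ∀ i, 0 < a i := fun i => lt_of_lt_of_le (by positivity) (ha i).1
  have hpos : (S⁻¹).PosDef := hΘ.posDef_iff_eigenvalues_pos.2 ha0
  have hinv : (S⁻¹)⁻¹ = S := Matrix.nonsing_inv_nonsing_inv S hu
  have hSU : S = U * diagonal (fun i => (a i)⁻¹) * Uᵀ := by
    rw [← hinv]
    refine inv_eq_right_inv ?_
    rw [hA]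
    calc _ = U * diagonal a * (Uᵀ * U) * diagonal (fun i => (a i)⁻¹) * Uᵀ := by
          simp only [Matrix.mul_assoc]
      _ = U * (diagonal a * diagonal (fun i => (a i)⁻¹)) * Uᵀ := by
          rw [hU1]; simp only [Matrix.mul_assoc, Matrix.one_mul]
      _ = 1 := by
          rw [diagonal_mul_diagonal]
          simp only [mul_inv_cancel₀ (ha0 _).ne', diagonal_one, Matrix.mul_one, hU2]
  have hb : ∀ i, 1 / L ≤ (a i)⁻¹ ∧ (a i)⁻¹ ≤ L := fun i => by
    constructor
    · rw [one_div]; exact inv_anti₀ (ha0 i) (ha i).2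
    · have := inv_anti₀ (by positivity) (ha i).1
      simpa using this
  have hsingle : ∀ i : ι, (Pi.single i (1 : ℝ) : ι → ℝ) ⬝ᵥ Pi.single i 1 = 1 := fun i => by simp
  have hdiag : ∀ (B : Matrix ι ι ℝ) i,
      (Pi.single i (1 : ℝ) : ι → ℝ) ⬝ᵥ (B *ᵥ Pi.single i 1) = B i i := fun B i => by simp
  refine ⟨by simpa [hinv] using hpos.inv, hpos, hinv, fun i => ?_, fun i => ?_, fun x y => ?_,
    fun x => ?_, fun j => ?_⟩
  · have := quadForm_le hU2 (fun i => (hb i).2) (Pi.single i (1 : ℝ))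
    rwa [← hSU, hsingle, hdiag, mul_one] at this
  · have := le_quadForm hU2 (fun i => (hb i).1) (Pi.single i (1 : ℝ))
    rwa [← hSU, hsingle, hdiag, mul_one] at this
  · refine (abs_dotProduct_le _ _).trans ?_
    have := mulVec_dotProduct_self_le hU1 hU2 (a := fun i => (a i)⁻¹) (u := L)
      (fun i => by rw [abs_of_pos (inv_pos.2 (ha0 i))]; exact (hb i).2) y
    rw [← hSU] at this
    have h2 : √((S *ᵥ y) ⬝ᵥ (S *ᵥ y)) ≤ L * √(y ⬝ᵥ y) := by
      refine (Real.sqrt_le_sqrt this).trans ?_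
      rw [Real.sqrt_mul (sq_nonneg _), Real.sqrt_sq hL0.le]
    calc _ ≤ √(x ⬝ᵥ x) * (L * √(y ⬝ᵥ y)) := by gcongr
      _ = _ := by ring
  · have := quadForm_le hU2 (fun i => (ha i).2) x
    rwa [← hA] at this
  · have := mulVec_dotProduct_self_le hU1 hU2
      (fun i => by rw [abs_of_pos (ha0 i)]; exact (ha i).2) (Pi.single j (1 : ℝ))
    rw [← hA, hsingle, mul_one] at this
    simpa [dotProduct, sq] using this

end Spectral

/-! ### Oracle inequality for the normalized graphical Lasso -/

section Oracle

variable {p : ℕ}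

/-- The `ℓ¹` norm of the off-diagonal entries. -/
def offNorm (A : Matrix (Fin p) (Fin p) ℝ) : ℝ :=
  ∑ q ∈ Finset.univ.filter (fun q : Fin p × Fin p => q.1 ≠ q.2), |A q.1 q.2|

lemma offNorm_eq (A : Matrix (Fin p) (Fin p) ℝ) :
    offNorm A = ∑ i, ∑ j, if i = j then 0 else |A i j| := by
  rw [offNorm, Finset.sum_filter, ← Finset.univ_product_univ, Finset.sum_product]
  simp only [ne_eq, ite_not]

/-- Hölder's inequality; a noise matrix with zero diagonal does not see the diagonal of the error.
-/
lemma abs_trace_mul_le_offNorm {A H : Matrix (Fin p) (Fin p) ℝ} (hH : H.IsHermitian)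
    (hA : ∀ i, A i i = 0) {ρ : ℝ} (hρ : ∀ i j, |A i j| ≤ ρ) :
    |(A * H).trace| ≤ ρ * offNorm H := by
  have h1 : (A * H).trace = ∑ i, ∑ j, A i j * H j i := by
    simp [Matrix.trace, Matrix.mul_apply]
  rw [h1, offNorm_eq, Finset.mul_sum]
  refine (Finset.abs_sum_le_sum_abs _ _).trans (Finset.sum_le_sum fun i _ => ?_)
  rw [Finset.mul_sum]
  refine (Finset.abs_sum_le_sum_abs _ _).trans (Finset.sum_le_sum fun j _ => ?_)
  split_ifs with h
  · subst h; simp [hA]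
  · have hsym : H j i = H i j := by
      have := congrFun (congrFun hH i) j
      simpa [conjTranspose_eq_transpose_of_trivial] using this
    rw [abs_mul, hsym]
    exact mul_le_mul_of_nonneg_right (hρ i j) (abs_nonneg _)

/-- Oracle inequality for the graphical Lasso whose input has the right diagonal. Either the
penalty dominates the noise, or no sparsity is exploited. -/
lemma glasso_oracle {R Γ₀ Γ : Matrix (Fin p) (Fin p) ℝ} (hΓ₀ : Γ₀.PosDef) (hΓ : Γ.PosDef)
    {c lam ρ m : ℝ} (hc : ∀ i, hΓ₀.1.eigenvalues i ≤ c) (hc0 : 0 ≤ c) (hlam : 0 < lam)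
    (hρ0 : 0 ≤ ρ) (hdiag : ∀ i, R i i = Γ₀⁻¹ i i) (hρ : ∀ i j, |R i j - Γ₀⁻¹ i j| ≤ ρ)
    {T : Finset (Fin p × Fin p)} (hT : ∀ q ∈ T, q.1 ≠ q.2)
    (hsupp : ∀ q : Fin p × Fin p, q.1 ≠ q.2 → q ∉ T → Γ₀ q.1 q.2 = 0)
    (hcase : ρ ≤ lam / 2 ∨ ∀ q : Fin p × Fin p, q.1 ≠ q.2 → q ∈ T)
    (hm : (T.card : ℝ) ≤ m) (hsmall : c * (lam + ρ) * √m ≤ 1 / 8)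
    (hmin : (R * Γ).trace - Real.log Γ.det + lam * offNorm Γ ≤
      (R * Γ₀).trace - Real.log Γ₀.det + lam * offNorm Γ₀) :
    √(frobSq (Γ - Γ₀)) ≤ 8 * c ^ 2 * (lam + ρ) * √m ∧
      offNorm (Γ - Γ₀) ≤ 4 * √m * √(frobSq (Γ - Γ₀)) := by
  set H := Γ - Γ₀ with hHdef
  have hHh : H.IsHermitian := hΓ.1.sub hΓ₀.1
  obtain ⟨x, hx0, hx1, hx2⟩ := exists_frobSq_sub_le hΓ₀ hΓ hc
  set q := (Γ₀⁻¹ * H).trace - (Real.log Γ.det - Real.log Γ₀.det) with hq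
  set F : Finset (Fin p × Fin p) := Finset.univ.filter (fun q => q.1 ≠ q.2) with hF
  have hTF : T ⊆ F := fun a ha => by simp [hF, hT a ha]
  set a₁ := ∑ q ∈ T, |H q.1 q.2| with ha₁
  set a₂ := ∑ q ∈ F \ T, |H q.1 q.2| with ha₂
  have ha₁0 : 0 ≤ a₁ := Finset.sum_nonneg fun _ _ => abs_nonneg _
  have ha₂0 : 0 ≤ a₂ := Finset.sum_nonneg fun _ _ => abs_nonneg _
  have hoff : offNorm H = a₁ + a₂ := by
    rw [offNorm, ← hF, ← Finset.sum_sdiff hTF, add_comm]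
  have htr : |((R - Γ₀⁻¹) * H).trace| ≤ ρ * (a₁ + a₂) := by
    rw [← hoff]
    exact abs_trace_mul_le_offNorm hHh (fun i => by simp [hdiag]) (fun i j => hρ i j)
  have hz : ∀ q ∈ F \ T, Γ₀ q.1 q.2 = 0 := fun q hq => by
    rw [Finset.mem_sdiff, hF, Finset.mem_filter] at hq
    exact hsupp q hq.1.2 hq.2
  have hpen : a₂ - a₁ ≤ offNorm Γ - offNorm Γ₀ := by
    rw [offNorm, offNorm, ← hF, ← Finset.sum_sdiff hTF, ← Finset.sum_sdiff hTF]
    have h1 : ∑ q ∈ F \ T, |Γ₀ q.1 q.2| = 0 :=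
      Finset.sum_eq_zero fun q hq => by rw [hz q hq, abs_zero]
    have h2 : ∑ q ∈ F \ T, |Γ q.1 q.2| = a₂ :=
      Finset.sum_congr rfl fun q hq => by rw [hHdef, Matrix.sub_apply, hz q hq, sub_zero]
    have h3 : ∑ q ∈ T, |Γ₀ q.1 q.2| ≤ ∑ q ∈ T, |Γ q.1 q.2| + a₁ := by
      rw [ha₁, ← Finset.sum_add_distrib]
      refine Finset.sum_le_sum fun q _ => ?_
      have := abs_sub_abs_le_abs_sub (Γ₀ q.1 q.2) (Γ q.1 q.2)
      rw [abs_sub_comm] at this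
      rw [hHdef, Matrix.sub_apply]
      linarith
    rw [h1, h2]
    linarith
  -- Basic inequality: the divergence `q` is the excess of the objective with the noiseless input,
  -- so minimality leaves only the noise term and the change of penalty.
  have hbasic : q ≤ ρ * (a₁ + a₂) + lam * (a₁ - a₂) := by
    have h1 : ((R - Γ₀⁻¹) * H).trace = (R * Γ).trace - (R * Γ₀).trace - (Γ₀⁻¹ * H).trace := by
      rw [Matrix.sub_mul, Matrix.trace_sub, hHdef, Matrix.mul_sub R, Matrix.trace_sub]
    have h2 := (abs_le.1 htr).1
    have h3 := mul_le_mul_of_nonneg_left hpen hlam.le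
    rw [h1] at h2
    rw [hq]
    linarith
  have hq0 : 0 ≤ q := le_trans (by positivity) hx2
  -- If `ρ ≤ lam / 2`, the coefficient of `a₂` is at most `-lam / 2`: dropping it bounds `q`, and `0
  -- ≤ q` gives the cone condition. Otherwise `T` contains all off-diagonal pairs and `a₂ = 0`.
  have hq1 : q ≤ (lam + ρ) * a₁ ∧ a₂ ≤ 3 * a₁ := by
    rcases hcase with h | h
    · constructor
      · nlinarith
      · have : lam * a₂ ≤ lam * (3 * a₁) := by nlinarith
        exact le_of_mul_le_mul_left this hlam
    · have : F \ T = ∅ := by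
        rw [Finset.sdiff_eq_empty_iff_subset]
        intro q hq
        exact h q (by simpa [hF] using hq)
      have : a₂ = 0 := by rw [ha₂, this, Finset.sum_empty]
      rw [this] at hbasic ⊢
      exact ⟨by linarith, by linarith⟩
  have hm0 : 0 ≤ m := (Nat.cast_nonneg _).trans hm
  have ha₁m : a₁ ≤ √m * √(frobSq H) := by
    rw [← Real.sqrt_mul hm0]
    apply Real.le_sqrt_of_sq_le
    have h1 : a₁ ^ 2 ≤ T.card * ∑ q ∈ T, |H q.1 q.2| ^ 2 := sq_sum_le_card_mul_sum_sq
    have h2 : ∑ q ∈ T, |H q.1 q.2| ^ 2 ≤ frobSq H := by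
      rw [frobSq, ← Finset.sum_product', Finset.univ_product_univ]
      simp only [sq_abs]
      exact Finset.sum_le_sum_of_subset_of_nonneg (Finset.subset_univ _)
        fun _ _ _ => sq_nonneg _
    exact h1.trans (mul_le_mul hm h2 (Finset.sum_nonneg fun _ _ => sq_nonneg _) hm0)
  have hfx : √(frobSq H) ≤ c * x := by
    refine (Real.sqrt_le_sqrt hx1).trans ?_
    rw [Real.sqrt_sq (by positivity)]
  -- The curvature bound reduces to `x ≤ 4a(1 + x)`; since `a ≤ 1/8`, the term `4ax` is at most
  -- `x/2` and is absorbed on the left.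
  have hx8 : x ≤ 8 * (c * (lam + ρ) * √m) := by
    set a := c * (lam + ρ) * √m
    have ha0 : 0 ≤ a := by positivity
    have h1 : x ^ 2 / (4 * (1 + x)) ≤ a * x := by
      refine hx2.trans (hq1.1.trans ?_)
      calc (lam + ρ) * a₁ ≤ (lam + ρ) * (√m * (c * x)) := by
            refine mul_le_mul_of_nonneg_left (ha₁m.trans ?_) (by positivity)
            exact mul_le_mul_of_nonneg_left hfx (Real.sqrt_nonneg _)
        _ = a * x := by ring
    rw [div_le_iff₀ (by positivity)] at h1
    rcases hx0.eq_or_lt with h | h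
    · rw [← h]; positivity
    · have h2 : x ≤ a * (4 * (1 + x)) := by
        have : x * x ≤ x * (a * (4 * (1 + x))) := by nlinarith
        exact le_of_mul_le_mul_left this h
      nlinarith
  constructor
  · refine hfx.trans ((mul_le_mul_of_nonneg_left hx8 hc0).trans (le_of_eq ?_))
    ring
  · rw [hoff]
    linarith [hq1.2, Real.sqrt_nonneg m]

end Oracle

/-! ### Deterministic bound for the estimation error and the remainder -/

section Remainder

variable {p : ℕ}

/-- Conjugation by `diagonal w` preserves the trace pairing, absorbs the penalty weights and shifts
`log det` by a constant. The two problems therefore have corresponding minimizers. -/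
lemma objective_eq_normalized {S Θ : Matrix (Fin p) (Fin p) ℝ} {w : Fin p → ℝ}
    (hw : ∀ i, 0 < w i) (hwS : ∀ i, √(S i i) = w i) (hΘ : 0 < Θ.det) (lam : ℝ) :
    objective S lam Θ =
      (Matrix.of (fun i j => S i j / (w i * w j)) * (diagonal w * Θ * diagonal w)).trace
        - Real.log (diagonal w * Θ * diagonal w).det
        + lam * offNorm (diagonal w * Θ * diagonal w) + 2 * Real.log (∏ i, w i) := by
  have hent : ∀ i j, (diagonal w * Θ * diagonal w) i j = w i * Θ i j * w j := fun i j => by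
    rw [mul_diagonal, diagonal_mul]
  have h1 : (Matrix.of (fun i j => S i j / (w i * w j)) *
      (diagonal w * Θ * diagonal w)).trace = (S * Θ).trace := by
    refine Finset.sum_congr rfl fun i _ => ?_
    rw [diag_apply, diag_apply, Matrix.mul_apply, Matrix.mul_apply]
    refine Finset.sum_congr rfl fun j _ => ?_
    rw [hent, of_apply]
    have := (hw i).ne'
    have := (hw j).ne'
    field_simp
  have hP : 0 < ∏ i, w i := Finset.prod_pos fun i _ => hw i
  have h2 : Real.log (diagonal w * Θ * diagonal w).det =
      Real.log Θ.det + 2 * Real.log (∏ i, w i) := by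
    rw [det_mul, det_mul, det_diagonal, Real.log_mul (by positivity) hP.ne',
      Real.log_mul hP.ne' hΘ.ne']
    ring
  have h3 : offNorm (diagonal w * Θ * diagonal w) =
      ∑ i, ∑ j, if i = j then 0 else √(S i i) * √(S j j) * |Θ i j| := by
    rw [offNorm_eq]
    refine Finset.sum_congr rfl fun i _ => Finset.sum_congr rfl fun j _ => ?_
    rw [hent, hwS, hwS, abs_mul, abs_mul, abs_of_pos (hw i), abs_of_pos (hw j)]
    split_ifs
    · rfl
    · ring
  rw [h1, h2, h3, objective]
  ring

lemma posDef_diagonal_conj {Θ : Matrix (Fin p) (Fin p) ℝ} (hΘ : Θ.PosDef) {w : Fin p → ℝ}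
    (hw : ∀ i, 0 < w i) : (diagonal w * Θ * diagonal w).PosDef := by
  have hu : IsUnit (diagonal w) := by
    rw [isUnit_iff_isUnit_det, det_diagonal]
    exact (Finset.prod_pos fun i _ => hw i).ne'.isUnit
  have := (Matrix.IsUnit.posDef_star_right_conjugate_iff (x := Θ) hu).2 hΘ
  simpa [star_eq_conjTranspose, conjTranspose_eq_transpose_of_trivial] using this

/-- Cauchy–Schwarz over the support of the column, which has at most `d + 1` elements, the diagonal
included. -/
lemma sum_abs_col_le {Θ : Matrix (Fin p) (Fin p) ℝ} {L : ℝ} (hL : 0 ≤ L)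
    (hcol : ∀ j, ∑ i, Θ i j ^ 2 ≤ L ^ 2) (j : Fin p) :
    ∑ i, |Θ i j| ≤ L * √(maxDegree Θ + 1 : ℝ) := by
  classical
  set s : Finset (Fin p) := Finset.univ.filter fun i => Θ i j ≠ 0 with hs
  have h0 : ∑ i, |Θ i j| = ∑ i ∈ s, |Θ i j| := by
    symm
    refine Finset.sum_subset (Finset.subset_univ _) fun i _ hi => ?_
    simpa [hs] using hi
  have hcard : (s.card : ℝ) ≤ maxDegree Θ + 1 := by
    have h1 : s.card ≤ nodeDegree Θ j + 1 := by
      have h2 : nodeDegree Θ j = (s.erase j).card := by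
        rw [nodeDegree, ← Set.ncard_coe_finset]
        congr 1
        ext i
        simp [hs, and_comm]
      rw [h2]
      have := Finset.pred_card_le_card_erase (s := s) (a := j)
      omega
    have h3 : nodeDegree Θ j ≤ maxDegree Θ := Finset.le_sup (f := nodeDegree Θ) (Finset.mem_univ j)
    exact_mod_cast h1.trans (by omega)
  rw [h0, mul_comm]
  refine le_of_sq_le_sq ?_ (by positivity)
  rw [mul_pow, Real.sq_sqrt (by positivity)]
  have h1 : (∑ i ∈ s, |Θ i j|) ^ 2 ≤ s.card * ∑ i ∈ s, |Θ i j| ^ 2 := sq_sum_le_card_mul_sum_sq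
  have h2 : ∑ i ∈ s, |Θ i j| ^ 2 ≤ L ^ 2 := by
    simp only [sq_abs]
    exact (Finset.sum_le_sum_of_subset_of_nonneg (Finset.subset_univ _)
      fun _ _ _ => sq_nonneg _).trans (hcol j)
  exact h1.trans (mul_le_mul hcard h2 (Finset.sum_nonneg fun _ _ => sq_nonneg _) (by positivity))

lemma abs_sandwich_le {A W B : Matrix (Fin p) (Fin p) ℝ} {τ a b : ℝ} (hτ : 0 ≤ τ)
    (hW : ∀ i j, |W i j| ≤ τ) (i j : Fin p) (ha : ∑ k, |A i k| ≤ a) (hb : ∑ k, |B k j| ≤ b) :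
    |(A * W * B) i j| ≤ a * τ * b := by
  have h1 : ∀ k, |(A * W) i k| ≤ a * τ := fun k => by
    rw [Matrix.mul_apply]
    refine (Finset.abs_sum_le_sum_abs _ _).trans ?_
    calc _ ≤ ∑ l, |A i l| * τ := Finset.sum_le_sum fun l _ => by
          rw [abs_mul]; exact mul_le_mul_of_nonneg_left (hW l k) (abs_nonneg _)
      _ ≤ _ := by rw [← Finset.sum_mul]; exact mul_le_mul_of_nonneg_right ha hτ
  have ha0 : 0 ≤ a := (Finset.sum_nonneg fun _ _ => abs_nonneg _).trans ha
  rw [Matrix.mul_apply]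
  refine (Finset.abs_sum_le_sum_abs _ _).trans ?_
  calc _ ≤ ∑ k, a * τ * |B k j| := Finset.sum_le_sum fun k _ => by
        rw [abs_mul]; exact mul_le_mul_of_nonneg_right (h1 k) (abs_nonneg _)
    _ ≤ _ := by rw [← Finset.mul_sum]; exact mul_le_mul_of_nonneg_left hb (by positivity)

/-- The remainder of the de-biased estimator in terms of the estimation error `D`. -/
lemma debiased_sub_eq {S C Θ D : Matrix (Fin p) (Fin p) ℝ} (h1 : C * Θ = 1) (h2 : Θ * C = 1) :
    debiased S (Θ + D) - Θ + Θ * (S - C) * Θ =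
      -(D * (S - C) * Θ) - Θ * (S - C) * D - D * C * D - D * (S - C) * D := by
  obtain ⟨W, rfl⟩ : ∃ W, S = C + W := ⟨S - C, by abel⟩
  have e1 : Θ * C * Θ = Θ := by rw [h2, Matrix.one_mul]
  have e2 : D * C * Θ = D := by rw [Matrix.mul_assoc, h1, Matrix.mul_one]
  have e3 : Θ * C * D = D := by rw [h2, Matrix.one_mul]
  have : debiased (C + W) (Θ + D) = (2 : ℝ) • Θ + (2 : ℝ) • D - (Θ * C * Θ + Θ * C * D +
      D * C * Θ + D * C * D + Θ * W * Θ + Θ * W * D + D * W * Θ + D * W * D) := by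
    rw [debiased, smul_add]
    simp only [Matrix.add_mul, Matrix.mul_add]
    abel
  rw [this, e1, e2, e3, add_sub_cancel_left, two_smul, two_smul]
  abel

lemma abs_mul_sub_one_le {a b e : ℝ} (ha : |a - 1| ≤ e) (hb : |b - 1| ≤ e) (he : e ≤ 1) :
    |a * b - 1| ≤ 3 * e := by
  have : a * b - 1 = (a - 1) * (b - 1) + (a - 1) + (b - 1) := by ring
  rw [this]
  refine (abs_add_le _ _).trans ?_
  have h1 := abs_add_le ((a - 1) * (b - 1)) (a - 1)
  rw [abs_mul] at h1
  have h2 := mul_le_mul ha (hb.trans he) (abs_nonneg _) ((abs_nonneg _).trans ha)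
  linarith

/-- For `r ≥ 0`, `|r² - 1| = |r - 1| (r + 1) ≥ |r - 1|`, so the relative error of a standard
deviation is at most that of the variance. -/
lemma abs_sqrt_div_sqrt_sub_one_le {s t τ L : ℝ} (hL : 0 < L) (hs : 1 / (2 * L) ≤ s) (ht : 0 ≤ t)
    (h : |s - t| ≤ τ) : |√t / √s - 1| ≤ 2 * L * τ := by
  have hs0 : 0 < s := lt_of_lt_of_le (by positivity) hs
  have hr : 0 ≤ √t / √s := by positivity
  have h1 : |(√t / √s) ^ 2 - 1| ≤ 2 * L * τ := by
    rw [div_pow, Real.sq_sqrt ht, Real.sq_sqrt hs0.le]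
    have : t / s - 1 = -(s - t) / s := by field_simp; ring
    rw [this, abs_div, abs_neg, abs_of_pos hs0, div_le_iff₀ hs0]
    have h2 : 1 ≤ 2 * L * s := by
      rw [div_le_iff₀ (by positivity)] at hs; linarith
    nlinarith [(abs_nonneg _).trans h]
  have h3 : |(√t / √s) ^ 2 - 1| = |√t / √s - 1| * (√t / √s + 1) := by
    rw [show (√t / √s) ^ 2 - 1 = (√t / √s - 1) * (√t / √s + 1) by ring, abs_mul,
      abs_of_nonneg (by positivity : 0 ≤ √t / √s + 1)]
  rw [h3] at h1
  nlinarith [abs_nonneg (√t / √s - 1)]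

/-- Estimation error of the weighted graphical Lasso, column by column. -/
theorem estimation_error_le {C Θ S Θh : Matrix (Fin p) (Fin p) ℝ} {L lam τ m : ℝ} (hL : 1 ≤ L)
    (hsp : SpectralBounds C Θ L) (hτ : ∀ i j, |S i j - C i j| ≤ τ)
    (hτ0 : 0 ≤ τ) (hτL : τ ≤ 1 / (2 * L)) (hlam : 0 < lam) {T : Finset (Fin p × Fin p)}
    (hT : ∀ q ∈ T, q.1 ≠ q.2)
    (hsupp : ∀ q : Fin p × Fin p, q.1 ≠ q.2 → q ∉ T → Θ q.1 q.2 = 0)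
    (hcase : 8 * L * τ ≤ lam / 2 ∨ ∀ q : Fin p × Fin p, q.1 ≠ q.2 → q ∈ T)
    (hm : (T.card : ℝ) ≤ m) (hm1 : 1 ≤ m) (hD : √(maxDegree Θ + 1 : ℝ) ≤ 2 * m)
    (hsmall : 64 * L ^ 3 * (lam + τ) * m ≤ 1) (hmin : IsWeightedGlasso S lam Θh) :
    (∀ j, ∑ i, |(Θh - Θ) i j| ≤ 652 * L ^ 6 * (lam + τ) * m) ∧
      ∀ j, ∑ i, (Θh - Θ) i j ^ 2 ≤ 40000 * L ^ 12 * (lam + τ) ^ 2 * m := by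
  have hL0 : 0 < L := one_pos.trans_le hL
  have hm0 : 0 ≤ m := by linarith
  have hS_ge : ∀ i, 1 / (2 * L) ≤ S i i := fun i => by
    have h1 := (abs_le.1 (hτ i i)).1
    have h2 := hsp.le_diag i
    have h3 : 1 / L = 1 / (2 * L) + 1 / (2 * L) := by field_simp; norm_num
    linarith
  have hS_pos : ∀ i, 0 < S i i := fun i => lt_of_lt_of_le (by positivity) (hS_ge i)
  have hC_pos : ∀ i, 0 < C i i := fun i => lt_of_lt_of_le (by positivity) (hsp.le_diag i)
  set w : Fin p → ℝ := fun i => √(S i i) with hwdef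
  set v : Fin p → ℝ := fun i => √(C i i) with hvdef
  have hw : ∀ i, 0 < w i := fun i => Real.sqrt_pos.2 (hS_pos i)
  have hv : ∀ i, 0 < v i := fun i => Real.sqrt_pos.2 (hC_pos i)
  have hww : ∀ i j, 1 / (w i * w j) ≤ 2 * L := fun i j => by
    have h1 : ∀ i, √(1 / (2 * L)) ≤ w i := fun i => Real.sqrt_le_sqrt (hS_ge i)
    have h2 : 1 / (2 * L) ≤ w i * w j := by
      rw [← Real.mul_self_sqrt (by positivity : 0 ≤ 1 / (2 * L))]
      exact mul_le_mul (h1 i) (h1 j) (Real.sqrt_nonneg _) (hw i).le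
    have := one_div_le_one_div_of_le (by positivity) h2
    simpa using this
  have hr : ∀ i, |v i / w i - 1| ≤ 2 * L * τ := fun i =>
    abs_sqrt_div_sqrt_sub_one_le hL0 (hS_ge i) (hC_pos i).le (hτ i i)
  have hτ1 : 2 * L * τ ≤ 1 := by
    rw [le_div_iff₀ (by positivity)] at hτL; linarith
  have hrr : ∀ i j, |v i / w i * (v j / w j) - 1| ≤ 6 * L * τ := fun i j =>
    (abs_mul_sub_one_le (hr i) (hr j) hτ1).trans (by linarith)
  -- The inverse of the true correlation matrix, against the estimate rescaled by the sample
  -- standard deviations.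
  set Γ₀ := diagonal v * Θ * diagonal v with hΓ₀def
  set Γ := diagonal w * Θh * diagonal w with hΓdef
  have hΓ₀e : ∀ i j, Γ₀ i j = v i * Θ i j * v j := fun i j => by
    rw [hΓ₀def, mul_diagonal, diagonal_mul]
  have hΓe : ∀ i j, Γ i j = w i * Θh i j * w j := fun i j => by
    rw [hΓdef, mul_diagonal, diagonal_mul]
  have hΓ₀ : Γ₀.PosDef := posDef_diagonal_conj hsp.posDef hv
  have hΓ : Γ.PosDef := posDef_diagonal_conj hmin.1 hw
  set R : Matrix (Fin p) (Fin p) ℝ := Matrix.of fun i j => S i j / (w i * w j) with hR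
  have hCΘ : C * Θ = 1 := by
    rw [← hsp.inv_eq]; exact nonsing_inv_mul _ hsp.posDef.det_pos.ne'.isUnit
  have hΘC : Θ * C = 1 := mul_eq_one_comm.1 hCΘ
  have hΓ₀inv : ∀ i j, Γ₀⁻¹ i j = C i j / (v i * v j) := by
    have : Γ₀⁻¹ = diagonal (fun i => (v i)⁻¹) * C * diagonal (fun i => (v i)⁻¹) := by
      have hd : diagonal v * diagonal (fun i => (v i)⁻¹) = 1 := by
        rw [diagonal_mul_diagonal]
        simp only [mul_inv_cancel₀ (hv _).ne', diagonal_one]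
      refine inv_eq_right_inv ?_
      calc _ = diagonal v * Θ * (diagonal v * diagonal (fun i => (v i)⁻¹)) * C *
            diagonal (fun i => (v i)⁻¹) := by rw [hΓ₀def]; simp only [Matrix.mul_assoc]
        _ = diagonal v * (Θ * C) * diagonal (fun i => (v i)⁻¹) := by
            rw [hd]; simp only [Matrix.mul_assoc, Matrix.one_mul]
        _ = 1 := by rw [hΘC, Matrix.mul_one, hd]
    intro i j
    rw [this, mul_diagonal, diagonal_mul]
    have := (hv i).ne'
    have := (hv j).ne'
    field_simp
  -- `2Lτ` comes from the numerator of the correlation and `6Lτ` from replacing the standard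
  -- deviations.
  set ρ := 8 * L * τ with hρdef
  have hρ0 : 0 ≤ ρ := by positivity
  have hρ : ∀ i j, |R i j - Γ₀⁻¹ i j| ≤ ρ := fun i j => by
    rw [hΓ₀inv]
    have e : R i j - C i j / (v i * v j) = (S i j - C i j) * (1 / (w i * w j)) +
        C i j / (v i * v j) * (v i / w i * (v j / w j) - 1) := by
      rw [hR, of_apply]
      have := (hv i).ne'
      have := (hv j).ne'
      have := (hw i).ne'
      have := (hw j).ne'
      field_simp
      ring
    have h1 : |C i j / (v i * v j)| ≤ 1 := by
      rw [abs_div, abs_of_pos (mul_pos (hv i) (hv j)), div_le_one (mul_pos (hv i) (hv j))]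
      exact PosSemidef.abs_apply_le hsp.posDef_cov.posSemidef i j
    rw [e]
    refine (abs_add_le _ _).trans ?_
    rw [abs_mul, abs_mul, abs_of_pos (one_div_pos.2 (mul_pos (hw i) (hw j)))]
    have h2 := mul_le_mul (hτ i j) (hww i j) (one_div_pos.2 (mul_pos (hw i) (hw j))).le hτ0
    have h3 := mul_le_mul h1 (hrr i j) (abs_nonneg _) one_pos.le
    rw [hρdef]
    linarith
  have hdiag : ∀ i, R i i = Γ₀⁻¹ i i := fun i => by
    rw [hΓ₀inv, hR, of_apply]
    simp only [hwdef, hvdef]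
    rw [Real.mul_self_sqrt (hS_pos i).le, Real.mul_self_sqrt (hC_pos i).le,
      div_self (hS_pos i).ne', div_self (hC_pos i).ne']
  -- One factor `L` from the spectrum of `Θ`, one from the variances.
  have heig : ∀ i, hΓ₀.1.eigenvalues i ≤ L ^ 2 := by
    refine eigenvalues_le_of_quadForm_le hΓ₀.1 fun x => ?_
    rw [hΓ₀def, ← mulVec_mulVec, ← mulVec_mulVec, dotProduct_mulVec, ← mulVec_transpose,
      diagonal_transpose]
    refine (hsp.quad_le _).trans ?_
    rw [sq, mul_assoc]
    refine mul_le_mul_of_nonneg_left ?_ hL0.le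
    rw [dotProduct, dotProduct, Finset.mul_sum]
    refine Finset.sum_le_sum fun i _ => ?_
    rw [mulVec_diagonal]
    have h1 : v i * v i ≤ L := by
      simp only [hvdef]; rw [Real.mul_self_sqrt (hC_pos i).le]; exact hsp.diag_le i
    calc v i * x i * (v i * x i) = v i * v i * (x i * x i) := by ring
      _ ≤ _ := mul_le_mul_of_nonneg_right h1 (mul_self_nonneg _)
  have hmin' : (R * Γ).trace - Real.log Γ.det + lam * offNorm Γ ≤
      (R * Γ₀).trace - Real.log Γ₀.det + lam * offNorm Γ₀ := by
    -- The competitor is not `Θ` but the matrix whose rescaling by `w` is exactly `Γ₀`; it has the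
    -- same support as `Θ`.
    set Θs := diagonal (fun i => v i / w i) * Θ * diagonal (fun i => v i / w i) with hΘs
    have hpos : Θs.PosDef := posDef_diagonal_conj hsp.posDef fun i => div_pos (hv i) (hw i)
    have hle : objective S lam Θh ≤ objective S lam Θs := hmin.2 hpos
    rw [objective_eq_normalized hw (fun _ => rfl) hmin.1.det_pos,
      objective_eq_normalized hw (fun _ => rfl) hpos.det_pos] at hle
    have : diagonal w * Θs * diagonal w = Γ₀ := by
      ext i j
      rw [hΓ₀e, mul_diagonal, diagonal_mul, hΘs, mul_diagonal, diagonal_mul]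
      have := (hw i).ne'
      have := (hw j).ne'
      field_simp
    rw [this] at hle
    linarith
  have hsm : √m ≤ m := by
    rw [Real.sqrt_le_left hm0]; nlinarith
  have hlt0 : 0 ≤ lam + τ := by positivity
  have hlamρ : lam + ρ ≤ 8 * L * (lam + τ) := by
    rw [hρdef]; nlinarith
  have hsmall' : L ^ 2 * (lam + ρ) * √m ≤ 1 / 8 := by
    calc L ^ 2 * (lam + ρ) * √m ≤ L ^ 2 * (8 * L * (lam + τ)) * m := by gcongr
      _ = 64 * L ^ 3 * (lam + τ) * m / 8 := by ring
      _ ≤ 1 / 8 := by linarith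
  obtain ⟨hF, hO⟩ := glasso_oracle hΓ₀ hΓ heig (sq_nonneg L) hlam hρ0 hdiag hρ hT
    (fun q h1 h2 => by rw [hΓ₀e, hsupp q h1 h2]; ring) hcase hm hsmall' hmin'
  set H := Γ - Γ₀ with hH
  set f := √(frobSq H) with hf
  have hf0 : 0 ≤ f := Real.sqrt_nonneg _
  have hf1 : f ≤ 64 * L ^ 5 * (lam + τ) * √m := by
    refine hF.trans ?_
    calc 8 * (L ^ 2) ^ 2 * (lam + ρ) * √m ≤ 8 * (L ^ 2) ^ 2 * (8 * L * (lam + τ)) * √m := by gcongr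
      _ = _ := by ring
  -- Four parts from the off-diagonal norm and one from the diagonal entry, using `1 ≤ √m`.
  have hHcol : ∀ j, ∑ i, |H i j| ≤ 5 * √m * f := fun j => by
    have h1 : ∑ i, |H i j| ≤ |H j j| + offNorm H := by
      rw [← Finset.add_sum_erase _ _ (Finset.mem_univ j)]
      refine add_le_add_right ?_ _
      rw [offNorm]
      have : ∑ i ∈ Finset.univ.erase j, |H i j| =
          ∑ q ∈ (Finset.univ.erase j).map ⟨fun i => (i, j), Prod.mk_left_injective j⟩,
            |H q.1 q.2| := by
        rw [Finset.sum_map]; rfl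
      rw [this]
      refine Finset.sum_le_sum_of_subset_of_nonneg ?_ fun _ _ _ => abs_nonneg _
      intro q hq
      simp only [Finset.mem_map, Finset.mem_erase, Finset.mem_univ, and_true,
        Function.Embedding.coeFn_mk] at hq
      obtain ⟨i, hi, rfl⟩ := hq
      simpa using hi
    have h2 : |H j j| ≤ f := by
      apply Real.abs_le_sqrt
      exact (Finset.single_le_sum (f := fun k => H j k ^ 2) (fun _ _ => sq_nonneg _)
        (Finset.mem_univ j)).trans (Finset.single_le_sum (f := fun i => ∑ k, H i k ^ 2)
          (fun _ _ => Finset.sum_nonneg fun _ _ => sq_nonneg _) (Finset.mem_univ j))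
    have h3 : 1 ≤ √m := Real.one_le_sqrt.2 hm1
    nlinarith
  have hHcol2 : ∀ j, ∑ i, H i j ^ 2 ≤ f ^ 2 := fun j => by
    rw [hf, Real.sq_sqrt (frobSq_nonneg _), frobSq]
    exact Finset.sum_le_sum fun i _ => Finset.single_le_sum (f := fun k => H i k ^ 2)
      (fun _ _ => sq_nonneg _) (Finset.mem_univ j)
  set Δ := Θh - Θ with hΔ
  -- Undoing the scaling: the normalized error divided by `w i * w j`, plus `Θ` times the error of
  -- the scaling itself.
  have hΔe : ∀ i j, |Δ i j| ≤ 2 * L * |H i j| + 6 * L * τ * |Θ i j| := fun i j => by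
    have e : Δ i j = H i j * (1 / (w i * w j)) +
        Θ i j * (v i / w i * (v j / w j) - 1) := by
      rw [hΔ, hH, Matrix.sub_apply, Matrix.sub_apply, hΓe, hΓ₀e]
      have := (hw i).ne'
      have := (hw j).ne'
      field_simp
      ring
    rw [e]
    refine (abs_add_le _ _).trans ?_
    rw [abs_mul, abs_mul, abs_of_pos (one_div_pos.2 (mul_pos (hw i) (hw j)))]
    have h2 := mul_le_mul_of_nonneg_left (hww i j) (abs_nonneg (H i j))
    have h3 := mul_le_mul_of_nonneg_left (hrr i j) (abs_nonneg (Θ i j))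
    linarith
  have hΘcol := sum_abs_col_le hL0.le hsp.col_le
  set D := √(maxDegree Θ + 1 : ℝ) with hDdef
  have hsmm : √m * √m = m := Real.mul_self_sqrt hm0
  have hΔcol : ∀ j, ∑ i, |Δ i j| ≤ 652 * L ^ 6 * (lam + τ) * m := fun j => by
    calc ∑ i, |Δ i j| ≤ ∑ i, (2 * L * |H i j| + 6 * L * τ * |Θ i j|) :=
          Finset.sum_le_sum fun i _ => hΔe i j
      _ = 2 * L * ∑ i, |H i j| + 6 * L * τ * ∑ i, |Θ i j| := by
          rw [Finset.sum_add_distrib, Finset.mul_sum, Finset.mul_sum]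
      _ ≤ 2 * L * (5 * √m * (64 * L ^ 5 * (lam + τ) * √m)) + 6 * L * τ * (L * (2 * m)) := by
          have h1 := (hHcol j).trans (mul_le_mul_of_nonneg_left hf1 (by positivity))
          have h2 := (hΘcol j).trans (mul_le_mul_of_nonneg_left hD hL0.le)
          gcongr
      _ = 640 * L ^ 6 * (lam + τ) * (√m * √m) + 12 * (L ^ 2 * τ) * m := by ring
      _ ≤ 640 * L ^ 6 * (lam + τ) * m + 12 * (L ^ 6 * (lam + τ)) * m := by
          rw [hsmm]
          have h1 : L ^ 2 ≤ L ^ 6 := pow_le_pow_right₀ hL (by norm_num)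
          have h2 : τ ≤ lam + τ := by linarith
          gcongr
      _ = _ := by ring
  have hΔcol2 : ∀ j, ∑ i, Δ i j ^ 2 ≤ 40000 * L ^ 12 * (lam + τ) ^ 2 * m := fun j => by
    calc ∑ i, Δ i j ^ 2 ≤ ∑ i, (8 * L ^ 2 * H i j ^ 2 + 72 * L ^ 2 * τ ^ 2 * Θ i j ^ 2) := by
          refine Finset.sum_le_sum fun i _ => ?_
          have h1 := pow_le_pow_left₀ (abs_nonneg _) (hΔe i j) 2
          rw [sq_abs] at h1
          rw [← sq_abs (H i j), ← sq_abs (Θ i j)]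
          nlinarith [sq_nonneg (2 * L * |H i j| - 6 * L * τ * |Θ i j|)]
      _ = 8 * L ^ 2 * ∑ i, H i j ^ 2 + 72 * L ^ 2 * τ ^ 2 * ∑ i, Θ i j ^ 2 := by
          rw [Finset.sum_add_distrib, Finset.mul_sum, Finset.mul_sum]
      _ ≤ 8 * L ^ 2 * (64 * L ^ 5 * (lam + τ) * √m) ^ 2 + 72 * L ^ 2 * τ ^ 2 * L ^ 2 := by
          have h1 := (hHcol2 j).trans (pow_le_pow_left₀ hf0 hf1 2)
          have h2 := hsp.col_le j
          gcongr
      _ = 32768 * L ^ 12 * (lam + τ) ^ 2 * (√m * √m) + 72 * (L ^ 4 * τ ^ 2 * 1) := by ring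
      _ ≤ 32768 * L ^ 12 * (lam + τ) ^ 2 * m + 72 * (L ^ 12 * (lam + τ) ^ 2 * m) := by
          rw [hsmm]
          have h1 : L ^ 4 ≤ L ^ 12 := pow_le_pow_right₀ hL (by norm_num)
          have h2 : τ ≤ lam + τ := by linarith
          gcongr
      _ ≤ _ := by
          have : 0 ≤ L ^ 12 * (lam + τ) ^ 2 * m := by positivity
          nlinarith
  exact ⟨hΔcol, hΔcol2⟩

/-- The remainder of the de-biased weighted graphical Lasso. -/
theorem abs_remainder_le {C Θ S Θh : Matrix (Fin p) (Fin p) ℝ} {L lam τ m : ℝ} (hL : 1 ≤ L)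
    (hsp : SpectralBounds C Θ L) (hτ : ∀ i j, |S i j - C i j| ≤ τ)
    (hτ0 : 0 ≤ τ) (hτL : τ ≤ 1 / (2 * L)) (hlam : 0 < lam) {T : Finset (Fin p × Fin p)}
    (hT : ∀ q ∈ T, q.1 ≠ q.2)
    (hsupp : ∀ q : Fin p × Fin p, q.1 ≠ q.2 → q ∉ T → Θ q.1 q.2 = 0)
    (hcase : 8 * L * τ ≤ lam / 2 ∨ ∀ q : Fin p × Fin p, q.1 ≠ q.2 → q ∈ T)
    (hm : (T.card : ℝ) ≤ m) (hm1 : 1 ≤ m) (hD : √(maxDegree Θ + 1 : ℝ) ≤ 2 * m)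
    (hsmall : 64 * L ^ 3 * (lam + τ) * m ≤ 1) (hmin : IsWeightedGlasso S lam Θh) (i j : Fin p) :
    |(debiased S Θh - Θ + Θ * (S - C) * Θ) i j| ≤
      500000 * L ^ 13 * m * √(maxDegree Θ + 1 : ℝ) * (lam + τ) ^ 2 := by
  have hL0 : 0 < L := one_pos.trans_le hL
  have hm0 : 0 ≤ m := by linarith
  obtain ⟨hΔcol, hΔcol2⟩ := estimation_error_le hL hsp hτ hτ0 hτL hlam hT hsupp hcase hm hm1
    hD hsmall hmin
  have hΔh : (Θh - Θ).IsHermitian := hmin.1.1.sub hsp.posDef.1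
  have hCΘ : C * Θ = 1 := by
    rw [← hsp.inv_eq]; exact nonsing_inv_mul _ hsp.posDef.det_pos.ne'.isUnit
  have hΘC : Θ * C = 1 := mul_eq_one_comm.1 hCΘ
  have hΘh : Θh = Θ + (Θh - Θ) := by abel
  clear hmin hcase hsupp hT hm
  generalize Θh - Θ = Δ at *
  subst hΘh
  have hΘcol := sum_abs_col_le hL0.le hsp.col_le
  set D := √(maxDegree Θ + 1 : ℝ) with hDdef
  have hD1 : 1 ≤ D := Real.one_le_sqrt.2 (by linarith [Nat.cast_nonneg (α := ℝ) (maxDegree Θ)])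
  have hsymΔ : ∀ i j, Δ i j = Δ j i := fun i j => by
    have := congrFun (congrFun (hΔh) j) i
    simpa [conjTranspose_eq_transpose_of_trivial] using this
  have hsymΘ : ∀ i j, Θ i j = Θ j i := fun i j => by
    have := congrFun (congrFun hsp.posDef.1 j) i
    simpa [conjTranspose_eq_transpose_of_trivial] using this
  have hΔrow : ∀ i, ∑ j, |Δ i j| ≤ 652 * L ^ 6 * (lam + τ) * m := fun i => by
    simp only [hsymΔ i]; exact hΔcol i
  have hΘrow : ∀ i, ∑ j, |Θ i j| ≤ L * D := fun i => by
    simp only [hsymΘ i]; exact hΘcol i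
  have hW : ∀ i j, |(S - C) i j| ≤ τ := hτ
  have b1 := abs_sandwich_le hτ0 hW i j (hΔrow i) (hΘcol j)
  have b2 := abs_sandwich_le hτ0 hW i j (hΘrow i) (hΔcol j)
  have b4 := abs_sandwich_le hτ0 hW i j (hΔrow i) (hΔcol j)
  -- `C` is not entrywise small, so ℓ¹ norms would lose a factor `m` here. Instead, the operator
  -- norm of `C` is combined with the ℓ² norms of two columns of the error.
  have b3 : |(Δ * C * Δ) i j| ≤ L * (40000 * L ^ 12 * (lam + τ) ^ 2 * m) := by
    have e : (Δ * C * Δ) i j = (fun k => Δ k i) ⬝ᵥ (C *ᵥ fun k => Δ k j) := by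
      rw [Matrix.mul_assoc, Matrix.mul_apply]
      simp only [dotProduct, mulVec, Matrix.mul_apply]
      exact Finset.sum_congr rfl fun k _ => by rw [hsymΔ i k]
    rw [e]
    refine (hsp.bilin_le _ _).trans (mul_le_mul_of_nonneg_left ?_ hL0.le)
    have h : ∀ j, √((fun k => Δ k j) ⬝ᵥ fun k => Δ k j) ≤
        √(40000 * L ^ 12 * (lam + τ) ^ 2 * m) := fun j => by
      refine Real.sqrt_le_sqrt (le_trans (le_of_eq ?_) (hΔcol2 j))
      simp [dotProduct, sq]
    calc _ ≤ √(40000 * L ^ 12 * (lam + τ) ^ 2 * m) * √(40000 * L ^ 12 * (lam + τ) ^ 2 * m) :=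
          mul_le_mul (h i) (h j) (Real.sqrt_nonneg _) (Real.sqrt_nonneg _)
      _ = _ := Real.mul_self_sqrt (by positivity)
  rw [debiased_sub_eq hCΘ hΘC]
  set B := L ^ 13 * m * D * (lam + τ) ^ 2 with hB
  have hB0 : 0 ≤ B := by positivity
  have c1 : 652 * L ^ 6 * (lam + τ) * m * τ * (L * D) ≤ 652 * B := by
    calc _ = 652 * (L ^ 7 * m * D * ((lam + τ) * τ)) := by ring
      _ ≤ 652 * (L ^ 13 * m * D * ((lam + τ) * (lam + τ))) := by
          have h1 : L ^ 7 ≤ L ^ 13 := pow_le_pow_right₀ hL (by norm_num)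
          have h2 : τ ≤ lam + τ := by linarith
          gcongr
      _ = _ := by rw [hB]; ring
  have c3 : L * (40000 * L ^ 12 * (lam + τ) ^ 2 * m) ≤ 40000 * B := by
    calc _ = 40000 * (L ^ 13 * m * 1 * (lam + τ) ^ 2) := by ring
      _ ≤ _ := by rw [hB]; gcongr
  -- The cubic term carries `m²`; the smallness condition, through `(lam + τ) * m ≤ 1`, removes one
  -- factor `m`.
  have c4 : 652 * L ^ 6 * (lam + τ) * m * τ * (652 * L ^ 6 * (lam + τ) * m) ≤ 425104 * B := by
    have h0 : (lam + τ) * m ≤ 1 := by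
      have h1 : 1 ≤ 64 * L ^ 3 := by linarith [one_le_pow₀ hL (n := 3)]
      have h2 : 0 ≤ (lam + τ) * m := by positivity
      nlinarith
    calc _ = 425104 * (L ^ 12 * m * 1 * ((lam + τ) * τ) * ((lam + τ) * m)) := by ring
      _ ≤ 425104 * (L ^ 13 * m * D * ((lam + τ) * (lam + τ)) * 1) := by
          have h1 : L ^ 12 ≤ L ^ 13 := pow_le_pow_right₀ hL (by norm_num)
          have h2 : τ ≤ lam + τ := by linarith
          gcongr
      _ = _ := by rw [hB]; ring
  have c2 : L * D * τ * (652 * L ^ 6 * (lam + τ) * m) ≤ 652 * B := by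
    refine le_trans (le_of_eq ?_) c1; ring
  have hfin : |(-(Δ * (S - C) * Θ) - Θ * (S - C) * Δ - Δ * C * Δ - Δ * (S - C) * Δ) i j| ≤
      |(Δ * (S - C) * Θ) i j| + |(Θ * (S - C) * Δ) i j| + |(Δ * C * Δ) i j| +
        |(Δ * (S - C) * Δ) i j| := by
    simp only [Matrix.sub_apply (A := _ - _), Matrix.sub_apply (A := -_), Matrix.neg_apply]
    refine (abs_sub _ _).trans (add_le_add_left ((abs_sub _ _).trans
      (add_le_add_left ((abs_sub _ _).trans (add_le_add_left ?_ _)) _)) _)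
    rw [abs_neg]
  refine hfin.trans ?_
  have hgoal : 500000 * L ^ 13 * m * D * (lam + τ) ^ 2 = 500000 * B := by rw [hB]; ring
  rw [hgoal]
  linarith

end Remainder

/-! ### Sub-exponential variables and Bernstein's inequality -/

section SubExponential

lemma exp_le_one_add_add_sq (x : ℝ) : Real.exp x ≤ 1 + x + x ^ 2 * Real.exp |x| := by
  have h1 : Real.exp x - 1 ≤ x * Real.exp x := by
    have := Real.add_one_le_exp (-x)
    have h2 : Real.exp (-x) * Real.exp x = 1 := by rw [← Real.exp_add]; simp
    nlinarith [Real.exp_pos x]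
  have h0 := Real.add_one_le_exp x
  rcases le_total 0 x with h | h
  · rw [abs_of_nonneg h]; nlinarith
  · rw [abs_of_nonpos h]
    have h3 : 1 ≤ Real.exp (-x) := Real.one_le_exp (by linarith)
    nlinarith [sq_nonneg x]

lemma sq_le_eight_mul_exp {u : ℝ} (hu : 0 ≤ u) : u ^ 2 ≤ 8 * Real.exp (u / 2) := by
  have := Real.quadratic_le_exp_of_nonneg (x := u / 2) (by linarith)
  nlinarith

lemma pow_three_le_mul_exp {u : ℝ} (hu : 0 ≤ u) : u ^ 3 ≤ 6 * Real.exp u := by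
  have := Real.pow_div_factorial_le_exp u hu 3
  norm_num [Nat.factorial] at this
  linarith

variable {Ω : Type*} [MeasurableSpace Ω] {P : Measure Ω}

/-- `Z` is sub-exponential with parameter `κ`. -/
structure SubExp (Z : Ω → ℝ) (κ : ℝ) (P : Measure Ω) : Prop where
  aemeasurable : AEMeasurable Z P
  lintegral_le : ∫⁻ ω, ENNReal.ofReal (Real.exp (|Z ω| / κ)) ∂P ≤ 2

variable {Z : Ω → ℝ} {κ : ℝ}

lemma SubExp.integrable_exp (h : SubExp Z κ P) : Integrable (fun ω => Real.exp (|Z ω| / κ)) P := by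
  have hm : AEMeasurable (fun ω => Real.exp (|Z ω| / κ)) P :=
    ((continuous_abs.measurable.comp_aemeasurable h.aemeasurable).div_const κ).exp
  refine ⟨hm.aestronglyMeasurable, ?_⟩
  rw [hasFiniteIntegral_iff_ofReal (Eventually.of_forall fun _ => (Real.exp_pos _).le)]
  exact h.lintegral_le.trans_lt (by norm_num)

lemma SubExp.integral_exp_le (h : SubExp Z κ P) : ∫ ω, Real.exp (|Z ω| / κ) ∂P ≤ 2 := by
  rw [integral_eq_lintegral_of_nonneg_ae (Eventually.of_forall fun _ => (Real.exp_pos _).le)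
    h.integrable_exp.aestronglyMeasurable]
  exact ENNReal.toReal_le_of_le_ofReal (by norm_num) (by simpa using h.lintegral_le)

lemma SubExp.integrable (h : SubExp Z κ P) (hκ : 0 < κ) : Integrable Z P := by
  refine (h.integrable_exp.const_mul κ).mono' h.aemeasurable.aestronglyMeasurable
    (Eventually.of_forall fun ω => ?_)
  have := Real.add_one_le_exp (|Z ω| / κ)
  rw [Real.norm_eq_abs]
  calc |Z ω| = κ * (|Z ω| / κ) := by field_simp
    _ ≤ _ := by gcongr; linarith

lemma SubExp.neg (h : SubExp Z κ P) : SubExp (fun ω => -Z ω) κ P :=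
  ⟨h.aemeasurable.neg, by simpa using h.lintegral_le⟩

variable [IsProbabilityMeasure P]

/-- Average `u ≤ exp u - 1` at `u = |Z| / κ`, whose exponential moment is at most 2. -/
lemma SubExp.abs_integral_le (h : SubExp Z κ P) (hκ : 0 < κ) : |∫ ω, Z ω ∂P| ≤ κ := by
  refine abs_integral_le_integral_abs.trans ?_
  have h1 : ∫ ω, |Z ω| ∂P ≤ ∫ ω, κ * (Real.exp (|Z ω| / κ) - 1) ∂P := by
    refine integral_mono (h.integrable hκ).abs
      ((h.integrable_exp.sub (integrable_const _)).const_mul κ) fun ω => ?_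
    have := Real.add_one_le_exp (|Z ω| / κ)
    calc |Z ω| = κ * (|Z ω| / κ) := by field_simp
      _ ≤ _ := by gcongr; linarith
  rw [integral_const_mul, integral_sub h.integrable_exp (integrable_const _)] at h1
  simp only [integral_const, probReal_univ, smul_eq_mul, mul_one] at h1
  have := h.integral_exp_le
  nlinarith

/-- The centred variable satisfies `E exp (|Z - EZ| / κ) ≤ 6`. -/
lemma SubExp.integral_exp_centered_le (h : SubExp Z κ P) (hκ : 0 < κ) :
    Integrable (fun ω => Real.exp (|Z ω - ∫ ω', Z ω' ∂P| / κ)) P ∧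
      ∫ ω, Real.exp (|Z ω - ∫ ω', Z ω' ∂P| / κ) ∂P ≤ 6 := by
  set e := ∫ ω', Z ω' ∂P
  have he : |e| ≤ κ := h.abs_integral_le hκ
  -- Since `|e| ≤ κ`, centring costs a factor `exp 1 < 3`.
  have hle : ∀ ω, Real.exp (|Z ω - e| / κ) ≤ 3 * Real.exp (|Z ω| / κ) := fun ω => by
    have h1 : |Z ω - e| / κ ≤ 1 + |Z ω| / κ := by
      rw [div_le_iff₀ hκ, add_mul, div_mul_cancel₀ _ hκ.ne']
      have := abs_sub (Z ω) e
      linarith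
    refine (Real.exp_le_exp.2 h1).trans ?_
    rw [Real.exp_add]
    exact mul_le_mul_of_nonneg_right (by linarith [Real.exp_one_lt_d9]) (Real.exp_pos _).le
  have hm : AEMeasurable (fun ω => Real.exp (|Z ω - e| / κ)) P :=
    ((continuous_abs.measurable.comp_aemeasurable (h.aemeasurable.sub_const e)).div_const κ).exp
  have hint : Integrable (fun ω => Real.exp (|Z ω - e| / κ)) P :=
    (h.integrable_exp.const_mul 3).mono' hm.aestronglyMeasurable
      (Eventually.of_forall fun ω => by
        rw [Real.norm_eq_abs, abs_of_pos (Real.exp_pos _)]; exact hle ω)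
  refine ⟨hint, (integral_mono hint (h.integrable_exp.const_mul 3) hle).trans ?_⟩
  rw [integral_const_mul]
  linarith [h.integral_exp_le]

/-- Second-order expansion of the exponential, whose linear term vanishes by centring. The
restriction on `θ` uses up only half of the available exponent; the other half pays for the square.
The constant is `48 = 8 * 6`, from `sq_le_eight_mul_exp` and the centred exponential moment. -/
lemma SubExp.mgf_centered_le (h : SubExp Z κ P) (hκ : 0 < κ) {θ : ℝ} (hθ : |θ| ≤ 1 / (2 * κ)) :
    Integrable (fun ω => Real.exp (θ * (Z ω - ∫ ω', Z ω' ∂P))) P ∧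
      mgf (fun ω => Z ω - ∫ ω', Z ω' ∂P) P θ ≤ Real.exp (48 * κ ^ 2 * θ ^ 2) := by
  obtain ⟨hint, hle⟩ := h.integral_exp_centered_le hκ
  have hZ := h.integrable hκ
  set e := ∫ ω', Z ω' ∂P with he
  have hbound : ∀ ω, |θ * (Z ω - e)| ≤ |Z ω - e| / κ / 2 := fun ω => by
    rw [abs_mul]
    calc _ ≤ 1 / (2 * κ) * |Z ω - e| := by gcongr
      _ = _ := by field_simp
  have hm : AEMeasurable (fun ω => Real.exp (θ * (Z ω - e))) P :=
    ((h.aemeasurable.sub_const e).const_mul θ).exp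
  have hexp : Integrable (fun ω => Real.exp (θ * (Z ω - e))) P :=
    hint.mono' hm.aestronglyMeasurable (Eventually.of_forall fun ω => by
      rw [Real.norm_eq_abs, abs_of_pos (Real.exp_pos _), Real.exp_le_exp]
      refine (le_abs_self _).trans ((hbound ω).trans (half_le_self ?_))
      positivity)
  refine ⟨hexp, ?_⟩
  have hpt : ∀ ω, Real.exp (θ * (Z ω - e)) ≤
      1 + θ * (Z ω - e) + 8 * κ ^ 2 * θ ^ 2 * Real.exp (|Z ω - e| / κ) := fun ω => by
    refine (exp_le_one_add_add_sq _).trans (by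
      refine add_le_add_right ?_ _
      set u := |Z ω - e| / κ with hu
      have hu0 : 0 ≤ u := by positivity
      have h1 : (θ * (Z ω - e)) ^ 2 = κ ^ 2 * θ ^ 2 * u ^ 2 := by
        rw [hu, div_pow, sq_abs]; field_simp
      have h2 := sq_le_eight_mul_exp hu0
      have h3 : Real.exp |θ * (Z ω - e)| ≤ Real.exp (u / 2) := Real.exp_le_exp.2 (hbound ω)
      have h4 : Real.exp u = Real.exp (u / 2) * Real.exp (u / 2) := by
        rw [← Real.exp_add]; ring_nf
      rw [h1, h4]
      calc _ ≤ κ ^ 2 * θ ^ 2 * (8 * Real.exp (u / 2)) * Real.exp (u / 2) := by gcongr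
        _ = _ := by ring)
  have hc : Integrable (fun ω => θ * (Z ω - e)) P := (hZ.sub (integrable_const _)).const_mul θ
  have hi : Integrable (fun ω => 1 + θ * (Z ω - e)) P := (integrable_const _).add hc
  have hone : ∫ ω, (1 + θ * (Z ω - e)) ∂P = 1 := by
    rw [integral_add (integrable_const _) hc, integral_const_mul,
      integral_sub hZ (integrable_const _)]
    simp [← he]
  rw [mgf]
  refine (integral_mono hexp (hi.add (hint.const_mul _)) hpt).trans ?_
  rw [integral_add' hi (hint.const_mul _), integral_const_mul, hone]
  have h5 := Real.add_one_le_exp (48 * κ ^ 2 * θ ^ 2)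
  have h6 : 0 ≤ 8 * κ ^ 2 * θ ^ 2 := by positivity
  nlinarith

/-- Bernstein's inequality, upper tail. -/
lemma bernstein_upper {n : ℕ} {Z : Fin n → Ω → ℝ} (hind : iIndepFun Z P) (hκ : 0 < κ)
    (hZ : ∀ k, SubExp (Z k) κ P) {t : ℝ} (ht : 0 ≤ t) (ht' : t ≤ 48 * κ) :
    P.real {ω | n * t ≤ ∑ k, (Z k ω - ∫ ω', Z k ω' ∂P)} ≤
      Real.exp (-(n * t ^ 2 / (192 * κ ^ 2))) := by
  set Y : Fin n → Ω → ℝ := fun k ω => Z k ω - ∫ ω', Z k ω' ∂P with hY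
  have hYm : ∀ k, AEMeasurable (Y k) P := fun k => (hZ k).aemeasurable.sub_const _
  have hYind : iIndepFun Y P :=
    hind.comp (fun k x => x - ∫ ω', Z k ω' ∂P) fun k => measurable_id.sub_const _
  -- The minimizer of `48κ²θ² - θt`; the bound `t ≤ 48κ` keeps it in the admissible range.
  set θ := t / (96 * κ ^ 2) with hθ
  have hθ0 : 0 ≤ θ := by positivity
  have hθ1 : |θ| ≤ 1 / (2 * κ) := by
    rw [abs_of_nonneg hθ0, hθ, div_le_div_iff₀ (by positivity) (by positivity)]
    nlinarith
  have hb := fun k => (hZ k).mgf_centered_le hκ hθ1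
  have hprod := hYind.mgf_sum₀ (t := θ) hYm Finset.univ
  have hpos : 0 < mgf (∑ k, Y k) P θ := by
    rw [hprod]; exact Finset.prod_pos fun k _ => mgf_pos (hb k).1
  -- Were the exponential not integrable, its moment generating function would take the default
  -- value 0, against `hpos`.
  have hint : Integrable (fun ω => Real.exp (θ * (∑ k, Y k) ω)) P := by
    by_contra hcon
    rw [mgf, integral_undef hcon] at hpos
    exact lt_irrefl _ hpos
  have h1 := measure_ge_le_exp_mul_mgf (μ := P) (X := ∑ k, Y k) (n * t) hθ0 hint
  have h2 : mgf (∑ k, Y k) P θ ≤ Real.exp (48 * κ ^ 2 * θ ^ 2) ^ n := by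
    rw [hprod]
    refine (Finset.prod_le_prod (fun k _ => mgf_nonneg) fun k _ => (hb k).2).trans (le_of_eq ?_)
    simp
  simp only [Finset.sum_apply] at h1
  refine h1.trans ((mul_le_mul_of_nonneg_left h2 (Real.exp_pos _).le).trans (le_of_eq ?_))
  rw [← Real.exp_nat_mul, ← Real.exp_add, hθ]
  congr 1
  field_simp
  ring

/-- Bernstein's inequality. -/
lemma bernstein {n : ℕ} {Z : Fin n → Ω → ℝ} (hind : iIndepFun Z P) (hκ : 0 < κ)
    (hZ : ∀ k, SubExp (Z k) κ P) {t : ℝ} (ht : 0 ≤ t) (ht' : t ≤ 48 * κ) :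
    P.real {ω | n * t ≤ |∑ k, (Z k ω - ∫ ω', Z k ω' ∂P)|} ≤
      2 * Real.exp (-(n * t ^ 2 / (192 * κ ^ 2))) := by
  have h1 := bernstein_upper hind hκ hZ ht ht'
  have h2 := bernstein_upper (Z := fun k ω => -Z k ω)
    (hind.comp (fun _ x => -x) fun _ => measurable_neg) hκ (fun k => (hZ k).neg) ht ht'
  have hsub : {ω | n * t ≤ |∑ k, (Z k ω - ∫ ω', Z k ω' ∂P)|} ⊆
      {ω | n * t ≤ ∑ k, (Z k ω - ∫ ω', Z k ω' ∂P)} ∪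
        {ω | n * t ≤ ∑ k, (-Z k ω - ∫ ω', -Z k ω' ∂P)} := fun ω hω => by
    simp only [Set.mem_union, Set.mem_ofPred_eq] at hω ⊢
    rcases le_abs.1 hω with h | h
    · exact Or.inl h
    · refine Or.inr (h.trans (le_of_eq ?_))
      rw [← Finset.sum_neg_distrib]
      refine Finset.sum_congr rfl fun k _ => ?_
      rw [integral_neg]; ring
  exact (measureReal_mono hsub).trans
    ((measureReal_union_le _ _).trans ((add_le_add h1 h2).trans (le_of_eq (two_mul _).symm)))

lemma SubExp.integral_abs_pow_three_le (h : SubExp Z κ P) (hκ : 0 < κ) :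
    Integrable (fun ω => |Z ω - ∫ ω', Z ω' ∂P| ^ 3) P ∧
      ∫ ω, |Z ω - ∫ ω', Z ω' ∂P| ^ 3 ∂P ≤ 36 * κ ^ 3 := by
  obtain ⟨hint, hle⟩ := h.integral_exp_centered_le hκ
  set e := ∫ ω', Z ω' ∂P
  have hpt : ∀ ω, |Z ω - e| ^ 3 ≤ 6 * κ ^ 3 * Real.exp (|Z ω - e| / κ) := fun ω => by
    have := pow_three_le_mul_exp (u := |Z ω - e| / κ) (by positivity)
    rw [div_pow, div_le_iff₀ (by positivity)] at this
    linarith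
  have hm : AEMeasurable (fun ω => |Z ω - e| ^ 3) P :=
    (continuous_abs.measurable.comp_aemeasurable (h.aemeasurable.sub_const e)).pow_const 3
  have hi : Integrable (fun ω => |Z ω - e| ^ 3) P :=
    (hint.const_mul (6 * κ ^ 3)).mono' hm.aestronglyMeasurable (Eventually.of_forall fun ω => by
      rw [Real.norm_eq_abs, abs_of_nonneg (by positivity)]; exact hpt ω)
  refine ⟨hi, (integral_mono hi (hint.const_mul _) hpt).trans ?_⟩
  rw [integral_const_mul]
  have : 0 ≤ 6 * κ ^ 3 := by positivity
  nlinarith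

end SubExponential

/-! ### Central limit theorem for triangular arrays -/

section TriangularCLT

lemma norm_exp_mul_I_sub_taylor_le (x : ℝ) :
    ‖Complex.exp (x * Complex.I) - (1 + x * Complex.I - (x : ℂ) ^ 2 / 2)‖ ≤ 4 * |x| ^ 3 := by
  have hI : (x * Complex.I) ^ 2 = -(x : ℂ) ^ 2 := by
    rw [mul_pow, Complex.I_sq]; ring
  have hn : ‖(x : ℂ) * Complex.I‖ = |x| := by simp
  rcases le_total |x| 1 with h | h
  · have := Complex.exp_bound (x := x * Complex.I) (by rw [hn]; exact h) (n := 3) (by norm_num)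
    simp only [Finset.sum_range_succ, Finset.range_zero, Finset.sum_empty, zero_add, pow_zero,
      pow_one, hI, hn] at this
    norm_num [Nat.factorial] at this
    have e : Complex.exp (x * Complex.I) - (1 + x * Complex.I - (x : ℂ) ^ 2 / 2) =
        Complex.exp (x * Complex.I) - (1 + x * Complex.I + -(x : ℂ) ^ 2 / 2) := by ring
    rw [e]
    refine this.trans ?_
    have : 0 ≤ |x| ^ 3 := by positivity
    linarith
  · refine (norm_sub_le _ _).trans ?_
    rw [Complex.norm_exp_ofReal_mul_I]
    have h1 : ‖1 + x * Complex.I - (x : ℂ) ^ 2 / 2‖ ≤ 1 + |x| + |x| ^ 2 / 2 := by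
      refine (norm_sub_le _ _).trans (add_le_add ((norm_add_le _ _).trans ?_) ?_)
      · rw [hn]; simp
      · simp
    have h2 : |x| ≤ |x| ^ 3 := le_self_pow₀ h (by norm_num)
    have h3 : |x| ^ 2 ≤ |x| ^ 3 := pow_le_pow_right₀ h (by norm_num)
    linarith

/-- Integrate the third-order Taylor bound for `exp (i s x)`; the moment assumptions evaluate the
quadratic polynomial exactly. -/
lemma norm_charFun_sub_le {ν : Measure ℝ} [IsProbabilityMeasure ν] (h0 : ∫ x, x ∂ν = 0)
    (h1 : ∫ x, x ^ 2 ∂ν = 1) {M : ℝ} (h3 : Integrable (fun x => |x| ^ 3) ν)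
    (hM : ∫ x, |x| ^ 3 ∂ν ≤ M) (s : ℝ) :
    ‖charFun ν s - (1 - (s : ℂ) ^ 2 / 2)‖ ≤ 4 * M * |s| ^ 3 := by
  have hle : ∀ x : ℝ, |x| ≤ 1 + |x| ^ 3 ∧ x ^ 2 ≤ 1 + |x| ^ 3 := fun x => by
    rw [← sq_abs x]
    rcases le_total |x| 1 with h | h
    · have h4 : |x| ^ 2 ≤ 1 := pow_le_one₀ (abs_nonneg _) h
      have : 0 ≤ |x| ^ 3 := by positivity
      exact ⟨by linarith, by linarith⟩
    · have h2 : |x| ≤ |x| ^ 3 := le_self_pow₀ h (by norm_num)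
      have h3 : |x| ^ 2 ≤ |x| ^ 3 := pow_le_pow_right₀ h (by norm_num)
      exact ⟨by linarith, by linarith⟩
  have hdom : Integrable (fun x : ℝ => 1 + |x| ^ 3) ν := (integrable_const _).add h3
  have hi1 : Integrable (fun x : ℝ => x) ν :=
    hdom.mono' aestronglyMeasurable_id (Eventually.of_forall fun x => (hle x).1)
  have hi2 : Integrable (fun x : ℝ => x ^ 2) ν :=
    hdom.mono' (by fun_prop) (Eventually.of_forall fun x => by
      rw [Real.norm_eq_abs, abs_of_nonneg (sq_nonneg x)]; exact (hle x).2)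
  have hi1c : Integrable (fun x : ℝ => (s : ℂ) * x * Complex.I) ν :=
    (hi1.ofReal.const_mul _).mul_const _
  have hi2c : Integrable (fun x : ℝ => ((s : ℂ) * x) ^ 2 / 2) ν := by
    have := (hi2.ofReal (𝕜 := ℂ)).const_mul ((s : ℂ) ^ 2 / 2)
    refine this.congr (Eventually.of_forall fun x => ?_)
    simp only [Complex.coe_algebraMap]
    push_cast
    ring
  have hexp : Integrable (fun x : ℝ => Complex.exp (s * x * Complex.I)) ν := by
    refine (integrable_const (1 : ℝ)).mono' (by fun_prop) (Eventually.of_forall fun x => ?_)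
    rw [← Complex.ofReal_mul, Complex.norm_exp_ofReal_mul_I]
  have hi1' : Integrable (fun x : ℝ => 1 + (s : ℂ) * x * Complex.I) ν :=
    (integrable_const _).add hi1c
  have hpoly : Integrable (fun x : ℝ => 1 + (s : ℂ) * x * Complex.I - ((s : ℂ) * x) ^ 2 / 2) ν :=
    hi1'.sub hi2c
  have hpi : ∫ x, (1 + (s : ℂ) * x * Complex.I - ((s : ℂ) * x) ^ 2 / 2) ∂ν =
      1 - (s : ℂ) ^ 2 / 2 := by
    rw [integral_sub hi1' hi2c, integral_add (integrable_const _) hi1c]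
    have e1 : ∫ x : ℝ, (s : ℂ) * x * Complex.I ∂ν = 0 := by
      rw [integral_mul_const, integral_const_mul, integral_complex_ofReal, h0]; simp
    have e2 : ∫ x : ℝ, ((s : ℂ) * x) ^ 2 / 2 ∂ν = (s : ℂ) ^ 2 / 2 := by
      have : ∀ x : ℝ, ((s : ℂ) * x) ^ 2 / 2 = (s : ℂ) ^ 2 / 2 * ((x ^ 2 : ℝ) : ℂ) := fun x => by
        push_cast; ring
      simp_rw [this]
      rw [integral_const_mul, integral_complex_ofReal, h1]; simp
    rw [e1, e2]; simp
  rw [charFun_apply_real, ← hpi, ← integral_sub hexp hpoly]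
  calc _ ≤ ∫ x, 4 * |s| ^ 3 * |x| ^ 3 ∂ν := by
        refine norm_integral_le_of_norm_le (h3.const_mul _) (Eventually.of_forall fun x => ?_)
        have := norm_exp_mul_I_sub_taylor_le (s * x)
        rw [abs_mul, mul_pow] at this
        push_cast at this
        linarith
    _ = 4 * |s| ^ 3 * ∫ x, |x| ^ 3 ∂ν := integral_const_mul _ _
    _ ≤ 4 * |s| ^ 3 * M := by gcongr
    _ = _ := by ring

lemma norm_exp_sub_exp_le (t a b : ℝ) :
    ‖Complex.exp (t * a * Complex.I) - Complex.exp (t * b * Complex.I)‖ ≤ |t| * |a - b| := by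
  have h1 : Complex.exp (t * a * Complex.I) = Complex.exp (t * b * Complex.I) *
      Complex.exp (Complex.I * ((t * (a - b) : ℝ) : ℂ)) := by
    rw [← Complex.exp_add]; congr 1; push_cast; ring
  have h2 : Complex.exp (t * a * Complex.I) - Complex.exp (t * b * Complex.I) =
      Complex.exp (t * b * Complex.I) *
        (Complex.exp (Complex.I * ((t * (a - b) : ℝ) : ℂ)) - 1) := by rw [h1]; ring
  rw [h2, norm_mul, ← Complex.ofReal_mul, Complex.norm_exp_ofReal_mul_I, one_mul]
  refine Real.norm_exp_I_mul_ofReal_sub_one_le.trans ?_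
  rw [Real.norm_eq_abs, abs_mul]

/-- Quantitative Slutsky: where `A` and `B` are close, `exp (i t ·)` is Lipschitz with constant
`|t|`; elsewhere the difference is at most 2. -/
lemma norm_charFun_map_sub_le {Ω : Type*} [MeasurableSpace Ω] {P : Measure Ω}
    [IsProbabilityMeasure P] {A B : Ω → ℝ} (hA : AEMeasurable A P) (hB : AEMeasurable B P)
    (t : ℝ) {e : ℝ} (he : 0 ≤ e) :
    ‖charFun (P.map A) t - charFun (P.map B) t‖ ≤ |t| * e + 2 * P.real {ω | e < |A ω - B ω|} := by
  have hc : ∀ {A : Ω → ℝ}, AEMeasurable A P →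
      charFun (P.map A) t = ∫ ω, Complex.exp (t * A ω * Complex.I) ∂P ∧
        Integrable (fun ω => Complex.exp (t * A ω * Complex.I)) P := fun {A} hA => by
    have hm : AEStronglyMeasurable (fun ω => Complex.exp (t * A ω * Complex.I)) P := by
      have : Continuous fun x : ℝ => Complex.exp (t * x * Complex.I) := by fun_prop
      exact (this.measurable.comp_aemeasurable hA).aestronglyMeasurable
    constructor
    · rw [charFun_apply_real, integral_map hA (by fun_prop)]
    · refine (integrable_const (1 : ℝ)).mono' hm (Eventually.of_forall fun x => ?_)
      rw [← Complex.ofReal_mul, Complex.norm_exp_ofReal_mul_I]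
  rw [(hc hA).1, (hc hB).1, ← integral_sub (hc hA).2 (hc hB).2]
  -- The exceptional set need not be measurable, as `A` and `B` are only almost everywhere
  -- measurable; a measurable hull has the same mass.
  set E := toMeasurable P {ω | e < |A ω - B ω|} with hE
  have hEm : MeasurableSet E := measurableSet_toMeasurable _ _
  have hPE : P.real E = P.real {ω | e < |A ω - B ω|} := by
    rw [measureReal_def, measureReal_def, measure_toMeasurable]
  have hi2 : Integrable (E.indicator fun _ => (2 : ℝ)) P := (integrable_const _).indicator hEm
  calc _ ≤ ∫ ω, (|t| * e + E.indicator (fun _ => (2 : ℝ)) ω) ∂P := by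
        refine norm_integral_le_of_norm_le ((integrable_const _).add hi2)
          (Eventually.of_forall fun ω => ?_)
        by_cases h : ω ∈ E
        · rw [Set.indicator_of_mem h]
          refine (norm_sub_le _ _).trans ?_
          rw [← Complex.ofReal_mul, ← Complex.ofReal_mul, Complex.norm_exp_ofReal_mul_I,
            Complex.norm_exp_ofReal_mul_I]
          have : 0 ≤ |t| * e := by positivity
          linarith
        · rw [Set.indicator_of_notMem h, add_zero]
          have h' : |A ω - B ω| ≤ e := by
            by_contra hcon
            exact h (subset_toMeasurable P _ (not_le.1 hcon))
          exact (norm_exp_sub_exp_le _ _ _).trans (by gcongr)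
    _ = _ := by
        rw [integral_add (integrable_const _) hi2, integral_indicator_const _ hEm, hPE]
        simp [mul_comm]

/-- Central limit theorem for triangular arrays with i.i.d. rows and bounded third moments, up to
an error that vanishes in probability. -/
theorem tendstoInDistribution_triangular {Ω : ℕ → Type*} [∀ n, MeasurableSpace (Ω n)]
    {P : (n : ℕ) → Measure (Ω n)} [∀ n, IsProbabilityMeasure (P n)]
    {Y : (n : ℕ) → Fin n → Ω n → ℝ} {ν : ℕ → Measure ℝ} [∀ n, IsProbabilityMeasure (ν n)]
    {f : (n : ℕ) → Ω n → ℝ} (hf : ∀ n, AEMeasurable (f n) (P n))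
    (hind : ∀ n, iIndepFun (Y n) (P n)) (hlaw : ∀ n k, HasLaw (Y n k) (ν n) (P n)) {M : ℝ}
    (h0 : ∀ᶠ n in atTop, ∫ x, x ∂(ν n) = 0) (h1 : ∀ᶠ n in atTop, ∫ x, x ^ 2 ∂(ν n) = 1)
    (h3 : ∀ᶠ n in atTop, Integrable (fun x => |x| ^ 3) (ν n))
    (hM : ∀ᶠ n in atTop, ∫ x, |x| ^ 3 ∂(ν n) ≤ M)
    (hdiff : ∀ e : ℝ, 0 < e →
      Tendsto (fun n => P n {ω | e < |f n ω - (√(n : ℝ))⁻¹ * ∑ k, Y n k ω|}) atTop (𝓝 0)) :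
    TendstoInDistribution f atTop id P (gaussianReal 0 1) where
  forall_aemeasurable := hf
  aemeasurable_limit := aemeasurable_id
  tendsto := by
    refine ProbabilityMeasure.tendsto_iff_tendsto_charFun.2 fun t => ?_
    have hS : ∀ n, AEMeasurable (fun ω => ∑ k, Y n k ω) (P n) := fun n =>
      Finset.aemeasurable_fun_sum _ fun k _ => (hlaw n k).aemeasurable
    have hchar : ∀ n, charFun ((P n).map fun ω => (√(n : ℝ))⁻¹ * ∑ k, Y n k ω) t =
        charFun (ν n) ((√(n : ℝ))⁻¹ * t) ^ n := fun n => by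
      rw [charFun_map_mul_comp (hS n), (hind n).charFun_map_fun_sum_eq_prod
        fun k => (hlaw n k).aemeasurable]
      simp [fun k => (hlaw n k).map_eq]
    have hlim : Tendsto (fun n : ℕ => charFun (ν n) ((√(n : ℝ))⁻¹ * t) ^ n) atTop
        (𝓝 (Complex.exp (-t ^ 2 / 2))) := by
      apply Complex.tendsto_pow_exp_of_isLittleO_sub_add_div
      -- The Taylor error at `t / √n` is of order `n^(-3/2)`, hence `o(1/n)`, uniformly in the
      -- changing laws because `M` is common to them.
      have hb : (fun n : ℕ => charFun (ν n) ((√(n : ℝ))⁻¹ * t) - (1 + (-t ^ 2 / 2 : ℂ) / n))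
          =O[atTop] fun n : ℕ => (√(n : ℝ))⁻¹ * (1 / (n : ℝ)) := by
        refine Asymptotics.IsBigO.of_bound (4 * M * |t| ^ 3) ?_
        filter_upwards [h0, h1, h3, hM, eventually_gt_atTop 0] with n g0 g1 g3 gM hn
        have hn' : (0 : ℝ) < n := Nat.cast_pos.2 hn
        have := norm_charFun_sub_le g0 g1 g3 gM ((√(n : ℝ))⁻¹ * t)
        have hsq : (((√(n : ℝ))⁻¹ * t : ℝ) : ℂ) ^ 2 = (t : ℂ) ^ 2 / n := by
          rw [← Complex.ofReal_pow, mul_pow, inv_pow, Real.sq_sqrt hn'.le]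
          push_cast; ring
        have e : charFun (ν n) ((√(n : ℝ))⁻¹ * t) - (1 + (-t ^ 2 / 2 : ℂ) / n) =
            charFun (ν n) ((√(n : ℝ))⁻¹ * t) - (1 - (((√(n : ℝ))⁻¹ * t : ℝ) : ℂ) ^ 2 / 2) := by
          rw [hsq]; ring
        rw [e]
        refine this.trans (le_of_eq ?_)
        have h4 : (√(n : ℝ))⁻¹ ^ 3 = (√(n : ℝ))⁻¹ * (1 / n) := by
          rw [pow_succ, inv_pow, Real.sq_sqrt hn'.le]; ring
        rw [abs_mul, mul_pow, abs_of_nonneg (by positivity : 0 ≤ (√(n : ℝ))⁻¹), h4,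
          Real.norm_eq_abs, abs_of_nonneg (by positivity : 0 ≤ (√(n : ℝ))⁻¹ * (1 / (n : ℝ)))]
        ring
      refine hb.trans_isLittleO ?_
      have hsq : Tendsto (fun n : ℕ => (√(n : ℝ))⁻¹) atTop (𝓝 0) :=
        tendsto_inv_atTop_zero.comp (Real.tendsto_sqrt_atTop.comp tendsto_natCast_atTop_atTop)
      have h5 := (Asymptotics.isLittleO_one_iff ℝ).2 hsq |>.mul_isBigO
        (Asymptotics.isBigO_refl (fun n : ℕ => 1 / (n : ℝ)) atTop)
      rw [← Asymptotics.isLittleO_norm_right] at h5 ⊢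
      simpa using h5
    have hd : Tendsto (fun n => charFun ((P n).map (f n)) t -
        charFun ((P n).map fun ω => (√(n : ℝ))⁻¹ * ∑ k, Y n k ω) t) atTop (𝓝 0) := by
      rw [tendsto_zero_iff_norm_tendsto_zero, Metric.tendsto_atTop']
      intro δ hδ
      set e := δ / (2 * (|t| + 1)) with he
      have he0 : 0 < e := by positivity
      have hte : |t| * e ≤ δ / 2 := by
        rw [he, mul_div_assoc', div_le_div_iff₀ (by positivity) (by positivity)]
        nlinarith [abs_nonneg t]
      have h6 := (ENNReal.tendsto_toReal ENNReal.zero_ne_top).comp (hdiff e he0)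
      have h7 : ∀ᶠ n in atTop,
          (P n).real {ω | e < |f n ω - (√(n : ℝ))⁻¹ * ∑ k, Y n k ω|} < δ / 4 := by
        have := h6.eventually_lt_const (u := δ / 4) (by simpa using by linarith)
        exact this
      obtain ⟨N, hN⟩ := eventually_atTop.1 h7
      refine ⟨N, fun n hn => ?_⟩
      have h8 := norm_charFun_map_sub_le (hf n) ((hS n).const_mul (√(n : ℝ))⁻¹) t he0.le
      have h9 := hN n hn.le
      rw [Real.dist_eq, sub_zero, abs_of_nonneg (norm_nonneg _)]
      linarith
    have hg : charFun (gaussianReal 0 1) t = Complex.exp (-t ^ 2 / 2) := by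
      rw [charFun_gaussianReal]; simp [neg_div]
    have := hd.add (hlim.congr fun n => (hchar n).symm)
    simp only [sub_add_cancel, zero_add] at this
    simpa [hg] using this

end TriangularCLT

/-! ### Sub-Gaussian sampling: concentration and variance -/

section Model

variable {p : ℕ} {μ : Measure (Fin p → ℝ)}

lemma covMat_isHermitian : (covMat μ).IsHermitian := by
  ext i j
  simp [covMat, covariance_comm]

lemma BoundedSpectrum.spectralBounds {L : ℝ} (hL : 1 ≤ L) (h : BoundedSpectrum μ L) :
    SpectralBounds (covMat μ) (precMat μ) L :=
  spectralBounds_of_spectrum covMat_isHermitian h.1 hL h.2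

lemma exp_half_add_le (a b : ℝ) :
    Real.exp ((a + b) / 2) ≤ (Real.exp a + Real.exp b) / 2 := by
  have h1 : Real.exp a = Real.exp (a / 2) ^ 2 := by rw [← Real.exp_nat_mul]; ring_nf
  have h2 : Real.exp b = Real.exp (b / 2) ^ 2 := by rw [← Real.exp_nat_mul]; ring_nf
  have h3 : Real.exp ((a + b) / 2) = Real.exp (a / 2) * Real.exp (b / 2) := by
    rw [← Real.exp_add]; ring_nf
  rw [h1, h2, h3]
  nlinarith [sq_nonneg (Real.exp (a / 2) - Real.exp (b / 2))]

/-- After normalizing both vectors, `|yz| ≤ (y² + z²)/2` and convexity of the exponential bound the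
moment of the product by the mean of the two sub-Gaussian moments, so the constant 2 is kept. -/
lemma SubGaussian.subExp_bilin {K : ℝ} (hK : 0 < K) (h : SubGaussian μ K) {a b : Fin p → ℝ}
    {M : ℝ} (ha : 0 < a ⬝ᵥ a) (haM : a ⬝ᵥ a ≤ M) (hb : 0 < b ⬝ᵥ b) (hbM : b ⬝ᵥ b ≤ M) :
    SubExp (fun x => (a ⬝ᵥ x) * (b ⬝ᵥ x)) (M * K ^ 2) μ := by
  have hm : ∀ a : Fin p → ℝ, Measurable fun x : Fin p → ℝ => a ⬝ᵥ x := fun a =>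
    (by fun_prop : Continuous fun x : Fin p → ℝ => a ⬝ᵥ x).measurable
  refine ⟨((hm a).mul (hm b)).aemeasurable, ?_⟩
  have hM : 0 < M := ha.trans_le haM
  have hunit : ∀ {a : Fin p → ℝ}, 0 < a ⬝ᵥ a → a ⬝ᵥ a ≤ M →
      ∃ u : Fin p → ℝ, ∑ i, u i ^ 2 = 1 ∧ ∀ x, (a ⬝ᵥ x) ^ 2 ≤ M * (∑ i, u i * x i) ^ 2 := by
    intro a ha haM
    refine ⟨fun i => a i / √(a ⬝ᵥ a), ?_, fun x => ?_⟩
    · simp only [div_pow, Real.sq_sqrt ha.le]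
      rw [← Finset.sum_div, div_eq_one_iff_eq ha.ne']
      simp [dotProduct, sq]
    · have : ∑ i, a i / √(a ⬝ᵥ a) * x i = (a ⬝ᵥ x) / √(a ⬝ᵥ a) := by
        simp only [dotProduct, Finset.sum_div]
        exact Finset.sum_congr rfl fun i _ => by ring
      rw [this, div_pow, Real.sq_sqrt ha.le, mul_div_assoc', le_div_iff₀ ha, mul_comm M]
      exact mul_le_mul_of_nonneg_left haM (sq_nonneg _)
  obtain ⟨u, hu1, hu2⟩ := hunit ha haM
  obtain ⟨v, hv1, hv2⟩ := hunit hb hbM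
  have hpt : ∀ x : Fin p → ℝ, Real.exp (|(a ⬝ᵥ x) * (b ⬝ᵥ x)| / (M * K ^ 2)) ≤
      (Real.exp (|∑ i, u i * x i| ^ 2 / K ^ 2) + Real.exp (|∑ i, v i * x i| ^ 2 / K ^ 2)) / 2 := by
    intro x
    refine le_trans (Real.exp_le_exp.2 ?_) (exp_half_add_le _ _)
    rw [sq_abs, sq_abs, abs_mul, ← add_div, div_div, div_le_div_iff₀ (by positivity)
      (by positivity)]
    have h1 : 2 * (|a ⬝ᵥ x| * |b ⬝ᵥ x|) ≤ M * ((∑ i, u i * x i) ^ 2 + (∑ i, v i * x i) ^ 2) := by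
      have := two_mul_le_add_sq |a ⬝ᵥ x| |b ⬝ᵥ x|
      rw [sq_abs, sq_abs] at this
      linarith [hu2 x, hv2 x]
    nlinarith [mul_le_mul_of_nonneg_right h1 (sq_nonneg K)]
  have hmm : ∀ u : Fin p → ℝ, Measurable fun x : Fin p → ℝ =>
      ENNReal.ofReal (Real.exp (|∑ i, u i * x i| ^ 2 / K ^ 2)) := fun u => by
    refine ENNReal.measurable_ofReal.comp (Real.measurable_exp.comp ?_)
    exact (by fun_prop : Continuous fun x : Fin p → ℝ => |∑ i, u i * x i| ^ 2 / K ^ 2).measurable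
  calc ∫⁻ x, ENNReal.ofReal (Real.exp (|(a ⬝ᵥ x) * (b ⬝ᵥ x)| / (M * K ^ 2))) ∂μ
      ≤ ∫⁻ x, (ENNReal.ofReal (Real.exp (|∑ i, u i * x i| ^ 2 / K ^ 2)) +
          ENNReal.ofReal (Real.exp (|∑ i, v i * x i| ^ 2 / K ^ 2))) / 2 ∂μ := by
        refine lintegral_mono fun x => ?_
        refine (ENNReal.ofReal_le_ofReal (hpt x)).trans (le_of_eq ?_)
        rw [ENNReal.ofReal_div_of_pos (by norm_num), ENNReal.ofReal_add (Real.exp_pos _).le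
          (Real.exp_pos _).le]
        simp
    _ = (∫⁻ x, ENNReal.ofReal (Real.exp (|∑ i, u i * x i| ^ 2 / K ^ 2)) ∂μ +
          ∫⁻ x, ENNReal.ofReal (Real.exp (|∑ i, v i * x i| ^ 2 / K ^ 2)) ∂μ) / 2 := by
        rw [div_eq_mul_inv, ← lintegral_add_left (hmm u),
          ← lintegral_mul_const _ (by exact (hmm u).add (hmm v))]
        simp only [div_eq_mul_inv]
    _ ≤ (2 + 2) / 2 := by gcongr <;> exact h _ ‹_›
    _ = 2 := by
        rw [ENNReal.add_div, ENNReal.div_self (by norm_num) (by norm_num), one_add_one_eq_two]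

lemma SubGaussian.subExp_coord {K : ℝ} (hK : 0 < K) (h : SubGaussian μ K) (i j : Fin p) :
    SubExp (fun x => x i * x j) (K ^ 2) μ := by
  have := h.subExp_bilin hK (a := Pi.single i 1) (b := Pi.single j 1) (M := 1) (by simp) (by simp)
    (by simp) (by simp)
  simpa using this

lemma covMat_apply (h0 : ∀ i, ∫ x, x i ∂μ = 0) (i j : Fin p) :
    covMat μ i j = ∫ x, x i * x j ∂μ := by
  simp [covMat, covariance, h0]

lemma SubExp.memLp_two {Ω : Type*} [MeasurableSpace Ω] {P : Measure Ω} {Z : Ω → ℝ} {κ : ℝ}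
    (h : SubExp Z κ P) (hκ : 0 < κ) : MemLp Z 2 P := by
  rw [memLp_two_iff_integrable_sq h.aemeasurable.aestronglyMeasurable]
  refine (h.integrable_exp.const_mul (8 * κ ^ 2)).mono'
    (h.aemeasurable.pow_const 2).aestronglyMeasurable (Eventually.of_forall fun ω => ?_)
  have h1 := sq_le_eight_mul_exp (u := |Z ω| / κ) (by positivity)
  have h2 : Real.exp (|Z ω| / κ / 2) ≤ Real.exp (|Z ω| / κ) :=
    Real.exp_le_exp.2 (half_le_self (by positivity))
  rw [div_pow, div_le_iff₀ (by positivity), sq_abs] at h1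
  rw [Real.norm_eq_abs, abs_of_nonneg (sq_nonneg _)]
  nlinarith [mul_le_mul_of_nonneg_right h2 (sq_nonneg κ)]

lemma HasLaw.comp_measurable {Ω E F : Type*} [MeasurableSpace Ω] [MeasurableSpace E]
    [MeasurableSpace F] {P : Measure Ω} {μ : Measure E} {X : Ω → E} (hX : HasLaw X μ P)
    {g : E → F} (hg : Measurable g) : HasLaw (fun ω => g (X ω)) (μ.map g) P where
  aemeasurable := hg.comp_aemeasurable hX.aemeasurable
  map_eq := by
    rw [← hX.map_eq, AEMeasurable.map_map_of_aemeasurable hg.aemeasurable hX.aemeasurable]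
    rfl

lemma SubExp.comp_hasLaw {Ω E : Type*} [MeasurableSpace Ω] [MeasurableSpace E]
    {P : Measure Ω} {μ : Measure E} {X : Ω → E} (hX : HasLaw X μ P) {g : E → ℝ}
    (hg : Measurable g) {κ : ℝ} (h : SubExp g κ μ) : SubExp (fun ω => g (X ω)) κ P := by
  refine ⟨hg.comp_aemeasurable hX.aemeasurable, ?_⟩
  refine (le_of_eq ?_).trans h.lintegral_le
  exact hX.lintegral_comp (f := fun x => ENNReal.ofReal (Real.exp (|g x| / κ)))
    (ENNReal.measurable_ofReal.comp (Real.measurable_exp.comp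
      ((continuous_abs.measurable.comp hg).div_const κ))).aemeasurable

lemma dotProduct_sampleCov_mulVec {n : ℕ} (x : Fin n → Fin p → ℝ) (a b : Fin p → ℝ) :
    a ⬝ᵥ (sampleCov x *ᵥ b) = (∑ k, (a ⬝ᵥ x k) * (b ⬝ᵥ x k)) / n := by
  have h : ∀ k, (a ⬝ᵥ x k) * (b ⬝ᵥ x k) = ∑ i, ∑ j, a i * (x k i * x k j) * b j := fun k => by
    rw [dotProduct, dotProduct, Finset.sum_mul_sum]
    exact Finset.sum_congr rfl fun i _ => Finset.sum_congr rfl fun j _ => by ring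
  simp only [h]
  simp only [dotProduct, mulVec, sampleCov, of_apply]
  rw [Finset.sum_comm, Finset.sum_div]
  refine Finset.sum_congr rfl fun i _ => ?_
  rw [Finset.sum_comm, Finset.sum_div, Finset.mul_sum]
  refine Finset.sum_congr rfl fun j _ => ?_
  rw [← Finset.sum_mul, ← Finset.mul_sum]
  ring

lemma dotProduct_covMat_mulVec {K : ℝ} (hK : 0 < K) [IsProbabilityMeasure μ]
    (h0 : ∀ i, ∫ x, x i ∂μ = 0) (h : SubGaussian μ K) (a b : Fin p → ℝ) :
    a ⬝ᵥ (covMat μ *ᵥ b) = ∫ x, (a ⬝ᵥ x) * (b ⬝ᵥ x) ∂μ := by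
  have hi : ∀ i j, Integrable (fun x : Fin p → ℝ => a i * (x i * x j) * b j) μ := fun i j =>
    (((h.subExp_coord hK i j).integrable (by positivity)).const_mul _).mul_const _
  have e : ∀ x : Fin p → ℝ, (a ⬝ᵥ x) * (b ⬝ᵥ x) = ∑ i, ∑ j, a i * (x i * x j) * b j := fun x => by
    rw [dotProduct, dotProduct, Finset.sum_mul_sum]
    exact Finset.sum_congr rfl fun i _ => Finset.sum_congr rfl fun j _ => by ring
  simp only [e]
  rw [integral_finsetSum _ fun i _ => integrable_finsetSum _ fun j _ => hi i j, dotProduct]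
  refine Finset.sum_congr rfl fun i _ => ?_
  rw [integral_finsetSum _ fun j _ => hi i j, mulVec, dotProduct, Finset.mul_sum]
  refine Finset.sum_congr rfl fun j _ => ?_
  rw [integral_mul_const, integral_const_mul, covMat_apply h0]
  ring

variable {n : ℕ} {Ω : Type*} [MeasurableSpace Ω] {P : Measure Ω}
  {X : Fin n → Ω → Fin p → ℝ}

/-- Entrywise concentration of the sample covariance matrix. -/
lemma measure_exists_lt_abs_le [IsProbabilityMeasure P] [IsProbabilityMeasure μ] {K : ℝ} (hK : 0 < K)
    (h0 : ∀ i, ∫ x, x i ∂μ = 0) (hsub : SubGaussian μ K) (hn : 0 < n) (hind : iIndepFun X P)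
    (hlaw : ∀ k, HasLaw (X k) μ P) {t : ℝ} (ht : 0 ≤ t) (ht' : t ≤ 48 * K ^ 2) :
    P {ω | ∃ i j, t < |sampleCov (fun k => X k ω) i j - covMat μ i j|} ≤
      ENNReal.ofReal (p ^ 2 * (2 * Real.exp (-(n * t ^ 2 / (192 * K ^ 4))))) := by
  have hn' : (0 : ℝ) < n := Nat.cast_pos.2 hn
  have hm : ∀ i j : Fin p, Measurable fun x : Fin p → ℝ => x i * x j := fun i j =>
    (measurable_pi_apply i).mul (measurable_pi_apply j)
  have hij : ∀ i j, P {ω | t < |sampleCov (fun k => X k ω) i j - covMat μ i j|} ≤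
      ENNReal.ofReal (2 * Real.exp (-(n * t ^ 2 / (192 * K ^ 4)))) := fun i j => by
    have hb := bernstein (P := P) (Z := fun k ω => X k ω i * X k ω j) (κ := K ^ 2)
      (hind.comp (fun _ x => x i * x j) fun _ => hm i j) (by positivity)
      (fun k => (hsub.subExp_coord hK i j).comp_hasLaw (hlaw k) (hm i j)) ht ht'
    have hE : ∀ k, ∫ ω, X k ω i * X k ω j ∂P = covMat μ i j := fun k => by
      rw [covMat_apply h0]
      exact (hlaw k).integral_comp (hm i j).aestronglyMeasurable
    rw [← ENNReal.ofReal_toReal (measure_ne_top P _)]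
    refine ENNReal.ofReal_le_ofReal (le_trans (measureReal_mono ?_) (hb.trans (le_of_eq ?_)))
    · intro ω hω
      simp only [Set.mem_ofPred_eq, hE] at hω ⊢
      have e : ∑ k, (X k ω i * X k ω j - covMat μ i j) =
          n * (sampleCov (fun k => X k ω) i j - covMat μ i j) := by
        rw [Finset.sum_sub_distrib, sampleCov, of_apply]
        simp only [Finset.sum_const, Finset.card_univ, Fintype.card_fin, nsmul_eq_mul]
        field_simp
      rw [e, abs_mul, abs_of_pos hn']
      exact mul_le_mul_of_nonneg_left hω.le hn'.le
    · rw [← pow_mul]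
  have hU : {ω | ∃ i j, t < |sampleCov (fun k => X k ω) i j - covMat μ i j|} =
      ⋃ q : Fin p × Fin p, {ω | t < |sampleCov (fun k => X k ω) q.1 q.2 - covMat μ q.1 q.2|} := by
    ext ω; simp
  rw [hU]
  refine (measure_iUnion_le _).trans ?_
  rw [tsum_fintype]
  refine (Finset.sum_le_sum fun q _ => hij q.1 q.2).trans (le_of_eq ?_)
  rw [Finset.sum_const, Finset.card_univ, Fintype.card_prod, Fintype.card_fin, nsmul_eq_mul,
    ENNReal.ofReal_mul (p := (p : ℝ) ^ 2) (by positivity)]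
  congr 1
  rw [← Nat.cast_pow, ENNReal.ofReal_natCast, sq]

/-- The asymptotic standard deviation is that of one summand. -/
lemma asympSD_eq [IsProbabilityMeasure μ] (hn : 0 < n) (hind : iIndepFun X P)
    (hlaw : ∀ k, HasLaw (X k) μ P) (i j : Fin p)
    (hZ : MemLp (fun x => ((fun a => precMat μ a i) ⬝ᵥ x) * ((fun a => precMat μ a j) ⬝ᵥ x)) 2 μ) :
    asympSD P μ X i j = √(Var[fun x => ((fun a => precMat μ a i) ⬝ᵥ x) *
      ((fun a => precMat μ a j) ⬝ᵥ x); μ]) := by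
  have hn' : (0 : ℝ) < n := Nat.cast_pos.2 hn
  set Z : (Fin p → ℝ) → ℝ := fun x =>
    ((fun a => precMat μ a i) ⬝ᵥ x) * ((fun a => precMat μ a j) ⬝ᵥ x) with hZdef
  have hm : Measurable Z :=
    (by rw [hZdef]; fun_prop : Continuous Z).measurable
  have hmem : ∀ k, MemLp (fun ω => Z (X k ω)) 2 P := fun k => by
    have : MemLp Z 2 (P.map (X k)) := by rwa [(hlaw k).map_eq]
    exact this.comp_of_map (hlaw k).aemeasurable
  have hvar : ∀ k, Var[fun ω => Z (X k ω); P] = Var[Z; μ] := fun k => by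
    rw [← (hlaw k).map_eq, variance_map hm.aemeasurable (hlaw k).aemeasurable]
    rfl
  have hs : Var[fun ω => ∑ k, Z (X k ω); P] = n * Var[Z; μ] := by
    have := IndepFun.variance_sum (s := Finset.univ) (X := fun k ω => Z (X k ω)) (μ := P)
      (fun k _ => hmem k) fun k _ l _ hkl =>
        (hind.comp (fun _ => Z) fun _ => hm).indepFun hkl
    have e : (∑ k, fun ω => Z (X k ω)) = fun ω => ∑ k, Z (X k ω) := by ext ω; simp
    rw [e] at this
    rw [this]
    simp [hvar]
  rw [asympSD]
  congr 1
  have e : (fun ω => (fun a => precMat μ a i) ⬝ᵥ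
      (sampleCov (fun k => X k ω) *ᵥ fun a => precMat μ a j)) =
      fun ω => (n : ℝ)⁻¹ * ∑ k, Z (X k ω) := by
    ext ω
    rw [dotProduct_sampleCov_mulVec, div_eq_inv_mul]
  rw [e, variance_const_mul, hs]
  field_simp

end Model

/-! ### Remainder bound in terms of sparsity, and the supremum norm -/

section Packaging

variable {p : ℕ}

lemma card_support_eq_sparsity (Θ : Matrix (Fin p) (Fin p) ℝ) :
    (Finset.univ.filter fun q : Fin p × Fin p => q.1 ≠ q.2 ∧ Θ q.1 q.2 ≠ 0).card =
      sparsity Θ := by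
  classical
  have h : ∀ j, nodeDegree Θ j = ∑ i, if i ≠ j ∧ Θ i j ≠ 0 then 1 else 0 := fun j => by
    rw [← Finset.card_filter, nodeDegree, ← Set.ncard_coe_finset]
    congr 1
    ext i
    simp [and_comm]
  rw [Finset.card_filter, ← Finset.univ_product_univ, Finset.sum_product_right, sparsity]
  exact Finset.sum_congr rfl fun j _ => (h j).symm

lemma maxDegree_le_sparsity (Θ : Matrix (Fin p) (Fin p) ℝ) : maxDegree Θ ≤ sparsity Θ :=
  Finset.sup_le fun _ hj =>
    Finset.single_le_sum (f := nodeDegree Θ) (fun _ _ => Nat.zero_le _) hj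

/-- The remainder bound, with the index set taken to be the support of `Θ` if the penalty dominates
the noise, and everything otherwise. -/
lemma abs_remainder_le_of_sparsity {C Θ S Θh : Matrix (Fin p) (Fin p) ℝ} {L lam τ m : ℝ}
    (hL : 1 ≤ L) (hsp : SpectralBounds C Θ L) (hτ : ∀ i j, |S i j - C i j| ≤ τ) (hτ0 : 0 ≤ τ)
    (hτL : τ ≤ 1 / (2 * L)) (hlam : 0 < lam) (hcase : 8 * L * τ ≤ lam / 2 ∨ (p : ℝ) ^ 2 ≤ m)
    (hm : max (sparsity Θ : ℝ) 1 ≤ m) (hsmall : 64 * L ^ 3 * (lam + τ) * m ≤ 1)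
    (hmin : IsWeightedGlasso S lam Θh) (i j : Fin p) :
    |(debiased S Θh - Θ + Θ * (S - C) * Θ) i j| ≤
      500000 * L ^ 13 * m * √(maxDegree Θ + 1 : ℝ) * (lam + τ) ^ 2 := by
  have hm1 : 1 ≤ m := (le_max_right _ _).trans hm
  have hms : (sparsity Θ : ℝ) ≤ m := (le_max_left _ _).trans hm
  have hD : √(maxDegree Θ + 1 : ℝ) ≤ 2 * m := by
    rw [Real.sqrt_le_left (by positivity)]
    have : (maxDegree Θ : ℝ) ≤ m := le_trans (by exact_mod_cast maxDegree_le_sparsity Θ) hms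
    nlinarith
  rcases hcase with h | h
  · refine abs_remainder_le hL hsp hτ hτ0 hτL hlam
      (T := Finset.univ.filter fun q : Fin p × Fin p => q.1 ≠ q.2 ∧ Θ q.1 q.2 ≠ 0)
      (fun q hq => (Finset.mem_filter.1 hq).2.1) (fun q h1 h2 => ?_) (Or.inl h) ?_ hm1 hD hsmall
      hmin i j
    · by_contra hne
      exact h2 (by simp [h1, hne])
    · rw [card_support_eq_sparsity]; exact hms
  · refine abs_remainder_le hL hsp hτ hτ0 hτL hlam
      (T := Finset.univ.filter fun q : Fin p × Fin p => q.1 ≠ q.2)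
      (fun q hq => (Finset.mem_filter.1 hq).2) (fun q h1 h2 => absurd (by simpa using h1) h2)
      (Or.inr fun q hq => by simpa using hq) ?_ hm1 hD hsmall hmin i j
    refine le_trans ?_ h
    have := Finset.card_filter_le (Finset.univ : Finset (Fin p × Fin p)) fun q => q.1 ≠ q.2
    rw [Finset.card_univ, Fintype.card_prod, Fintype.card_fin] at this
    rw [sq]
    exact_mod_cast this

lemma exists_isWeightedGlasso_of_close {C Θ S : Matrix (Fin p) (Fin p) ℝ} {L lam τ : ℝ}
    (hL : 1 ≤ L) (hsp : SpectralBounds C Θ L) (hS : S.PosSemidef)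
    (hτ : ∀ i j, |S i j - C i j| ≤ τ) (hτL : τ ≤ 1 / (2 * L)) (hlam : 0 < lam) :
    ∃ Θh, IsWeightedGlasso S lam Θh := by
  refine exists_isWeightedGlasso hS (fun i => ?_) hlam
  have hL0 : 0 < L := one_pos.trans_le hL
  have h1 := (abs_le.1 (hτ i i)).1
  have h2 := hsp.le_diag i
  have h3 : 1 / L = 1 / (2 * L) + 1 / (2 * L) := by field_simp; norm_num
  have h4 : 0 < 1 / (2 * L) := by positivity
  linarith

lemma abs_apply_le_supNorm (A : Matrix (Fin p) (Fin p) ℝ) (i j : Fin p) : |A i j| ≤ supNorm A :=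
  le_ciSup (f := fun ij : Fin p × Fin p => |A ij.1 ij.2|) (Set.finite_range _).bddAbove (i, j)

lemma abs_supNorm_le {A : Matrix (Fin p) (Fin p) ℝ} {b : ℝ} (hb : 0 ≤ b)
    (h : ∀ i j, |A i j| ≤ b) : |supNorm A| ≤ b := by
  rw [supNorm, abs_of_nonneg (Real.iSup_nonneg fun _ => abs_nonneg _)]
  exact Real.iSup_le (fun ij => h ij.1 ij.2) hb

end Packaging

/-! ### Rates, stochastic orders and the union bound -/

section Asymptotics

/-- As `d ≥ 1`, the sequence is `o(√n / lp · √(lp / n)) = o(1 / √lp)`, and `lp` is bounded below.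
This supplies the smallness condition of the deterministic bound. -/
lemma tendsto_sparsity_mul_rate {s d lp : ℕ → ℝ} {c : ℝ} (hc : 0 < c) (hs : ∀ n, 1 ≤ s n)
    (hd : ∀ n, 1 ≤ d n) (hlp : ∀ n, c ≤ lp n)
    (h : (fun n => s n * √(d n)) =o[atTop] fun n : ℕ => √(n : ℝ) / lp n) :
    Tendsto (fun n => s n * √(lp n / n)) atTop (𝓝 0) := by
  rw [← Asymptotics.isLittleO_one_iff ℝ]
  have h1 := h.mul_isBigO (Asymptotics.isBigO_refl (fun n : ℕ => √(lp n / n)) atTop)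
  have h2 : (fun n : ℕ => s n * √(lp n / n)) =O[atTop] fun n => s n * √(d n) * √(lp n / n) := by
    refine Asymptotics.IsBigO.of_bound 1 (Eventually.of_forall fun n => ?_)
    have := hs n
    rw [Real.norm_eq_abs, Real.norm_eq_abs, abs_of_nonneg (by positivity),
      abs_of_nonneg (by positivity), one_mul]
    refine mul_le_mul_of_nonneg_right ?_ (Real.sqrt_nonneg _)
    exact le_mul_of_one_le_right (by positivity) (Real.one_le_sqrt.2 (hd n))
  refine (h2.trans_isLittleO h1).trans_isBigO ?_
  refine Asymptotics.IsBigO.of_bound (1 / √c) ?_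
  filter_upwards [eventually_gt_atTop 0] with n hn
  have hn' : (0 : ℝ) < n := Nat.cast_pos.2 hn
  have hl : 0 < lp n := hc.trans_le (hlp n)
  have e : √(n : ℝ) / lp n * √(lp n / n) = 1 / √(lp n) := by
    rw [Real.sqrt_div hl.le]
    have h3 : √(lp n) * √(lp n) = lp n := Real.mul_self_sqrt hl.le
    have h4 : 0 < √(lp n) := Real.sqrt_pos.2 hl
    have h5 : 0 < √(n : ℝ) := Real.sqrt_pos.2 hn'
    rw [div_mul_div_comm, div_eq_div_iff (by positivity) (by positivity), one_mul, mul_assoc, h3]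
    ring
  rw [e, Real.norm_eq_abs, abs_of_nonneg (by positivity), norm_one, mul_one]
  exact one_div_le_one_div_of_le (Real.sqrt_pos.2 hc) (Real.sqrt_le_sqrt (hlp n))

/-- Multiply `o(√n / lp)` by `lam² = O(lp / n)`. The sequence `d'` stands for the maximal degree
plus one, at most twice its maximum with 1. -/
lemma isLittleO_remainder_rate {s d d' lp lam : ℕ → ℝ} (hs : ∀ n, 1 ≤ s n)
    (hlp : ∀ n, 0 < lp n) (hd' : ∀ n, d' n ≤ 2 * d n)
    (h : (fun n => s n * √(d n)) =o[atTop] fun n : ℕ => √(n : ℝ) / lp n)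
    (hlam : lam =O[atTop] fun n : ℕ => √(lp n / n)) (C : ℝ) :
    (fun n => C * s n * √(d' n) * lam n ^ 2) =o[atTop] fun n : ℕ => 1 / √(n : ℝ) := by
  have h1 : (fun n => C * s n * √(d' n)) =O[atTop] fun n => s n * √(d n) := by
    refine Asymptotics.IsBigO.of_bound (|C| * √2) (Eventually.of_forall fun n => ?_)
    have h3 : 0 ≤ s n := zero_le_one.trans (hs n)
    rw [Real.norm_eq_abs, Real.norm_eq_abs, abs_mul, abs_mul, abs_of_nonneg h3,
      abs_of_nonneg (Real.sqrt_nonneg (d' n)), abs_of_nonneg (by positivity : 0 ≤ s n * √(d n))]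
    have h2 : √(d' n) ≤ √2 * √(d n) := by
      rw [← Real.sqrt_mul (by norm_num)]; exact Real.sqrt_le_sqrt (hd' n)
    calc |C| * s n * √(d' n) ≤ |C| * s n * (√2 * √(d n)) := by gcongr
      _ = _ := by ring
  have h2 := (h1.trans_isLittleO h).mul_isBigO (hlam.pow 2)
  refine h2.trans_eventuallyEq ?_
  filter_upwards [eventually_gt_atTop 0] with n hn
  have hn' : (0 : ℝ) < n := Nat.cast_pos.2 hn
  have hl := hlp n
  have h5 : 0 < √(n : ℝ) := Real.sqrt_pos.2 hn'
  have h6 : √(n : ℝ) * √(n : ℝ) = n := Real.mul_self_sqrt hn'.le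
  rw [Real.sq_sqrt (by positivity), div_mul_div_comm, div_eq_div_iff (by positivity) h5.ne']
  linear_combination lp n * h6

variable {Ω : ℕ → Type*} [∀ n, MeasurableSpace (Ω n)] {P : (n : ℕ) → Measure (Ω n)}
  {Y : (n : ℕ) → Ω n → ℝ}

lemma tendsto_zero_of_eventually_le_ofReal {u : ℕ → ENNReal}
    (h : ∀ e : ℝ, 0 < e → ∀ᶠ n in atTop, u n ≤ ENNReal.ofReal e) : Tendsto u atTop (𝓝 0) := by
  rw [ENNReal.tendsto_nhds_zero]
  intro e he
  have h1 : 0 < min e 1 := lt_min he one_pos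
  have h2 : min e 1 ≠ ⊤ := ((min_le_right _ _).trans_lt ENNReal.one_lt_top).ne
  filter_upwards [h (min e 1).toReal (ENNReal.toReal_pos h1.ne' h2)] with n hn
  rw [ENNReal.ofReal_toReal h2] at hn
  exact hn.trans (min_le_left _ _)

lemma IsBigOP.isLittleOP {r r' : ℕ → ℝ} (h : IsBigOP P Y r) (hr : r =o[atTop] r')
    (hr' : ∀ᶠ n in atTop, 0 ≤ r' n) : IsLittleOP P Y r' := by
  intro e he
  refine tendsto_zero_of_eventually_le_ofReal fun δ hδ => ?_
  obtain ⟨M, hM⟩ := h δ hδ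
  filter_upwards [hM, hr', (hr.const_mul_left M).bound he] with n h1 h2 h3
  refine (measure_mono fun ω hω => ?_).trans h1
  rw [Real.norm_eq_abs, Real.norm_eq_abs, abs_of_nonneg h2] at h3
  exact ((le_abs_self _).trans h3).trans_lt hω

/-- The threshold with which the union bound is below `e`, uniformly in the dimension. -/
lemma exists_threshold {K e T₀ : ℝ} (hK : 0 < K) (he : 0 < e) :
    ∃ T : ℝ, T₀ ≤ T ∧ 0 ≤ T ∧ ∀ p : ℕ, 2 ≤ p →
      (p : ℝ) ^ 2 * (2 * Real.exp (-(T ^ 2 * Real.log p / (192 * K ^ 4)))) ≤ e := by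
  have hl2 : 0 < Real.log 2 := Real.log_pos (by norm_num)
  obtain ⟨A, hA0, hA⟩ : ∃ A : ℝ, 0 ≤ A ∧ 2 * Real.exp (-(A * Real.log 2)) ≤ e := by
    refine ⟨max 0 (-Real.log (e / 2) / Real.log 2), le_max_left _ _, ?_⟩
    have h1 : -Real.log (e / 2) ≤ max 0 (-Real.log (e / 2) / Real.log 2) * Real.log 2 := by
      rw [← div_le_iff₀ hl2]; exact le_max_right _ _
    have h2 : Real.exp (-(max 0 (-Real.log (e / 2) / Real.log 2) * Real.log 2)) ≤ e / 2 := by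
      rw [← Real.le_log_iff_exp_le (by positivity)]; linarith
    linarith
  -- In the exponent, `2 log p` cancels the factor `p²`, and `A log p ≥ A log 2` brings the rest
  -- below `e`.
  set T := max (max T₀ 0) √(192 * K ^ 4 * (2 + A)) with hT
  refine ⟨T, (le_max_left _ _).trans (le_max_left _ _), (le_max_right _ _).trans (le_max_left _ _),
    fun p hp => ?_⟩
  have hp' : (2 : ℝ) ≤ p := by exact_mod_cast hp
  have hlp : Real.log 2 ≤ Real.log p := Real.log_le_log (by norm_num) hp'
  have hT2 : 192 * K ^ 4 * (2 + A) ≤ T ^ 2 := by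
    have h1 : √(192 * K ^ 4 * (2 + A)) ≤ T := le_max_right _ _
    have h2 := pow_le_pow_left₀ (Real.sqrt_nonneg _) h1 2
    rwa [Real.sq_sqrt (by positivity)] at h2
  have h3 : (2 + A) * Real.log p ≤ T ^ 2 * Real.log p / (192 * K ^ 4) := by
    rw [le_div_iff₀ (by positivity)]
    nlinarith [mul_le_mul_of_nonneg_right hT2 (hl2.le.trans hlp)]
  have h4 : (p : ℝ) ^ 2 = Real.exp (2 * Real.log p) := by
    rw [two_mul, Real.exp_add, Real.exp_log (by linarith), sq]
  calc (p : ℝ) ^ 2 * (2 * Real.exp (-(T ^ 2 * Real.log p / (192 * K ^ 4))))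
      ≤ (p : ℝ) ^ 2 * (2 * Real.exp (-((2 + A) * Real.log p))) := by gcongr
    _ = 2 * Real.exp (-(A * Real.log p)) := by
        rw [h4, mul_left_comm, ← Real.exp_add]; ring_nf
    _ ≤ 2 * Real.exp (-(A * Real.log 2)) := by gcongr
    _ ≤ e := hA

/-- Above a universal threshold the union bound is of order `1 / p`. -/
lemma union_bound_le {K : ℝ} (hK : 0 < K) {p : ℕ} (hp : 2 ≤ p) :
    (p : ℝ) ^ 2 * (2 * Real.exp (-((24 * K ^ 2) ^ 2 * Real.log p / (192 * K ^ 4)))) ≤ 2 / p := by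
  have hp' : (0 : ℝ) < p := by positivity
  -- Here `24² / 192 = 3`: two powers of `p` pay for the union bound and one remains.
  have h1 : (24 * K ^ 2) ^ 2 * Real.log p / (192 * K ^ 4) = 3 * Real.log p := by
    field_simp; ring
  have h2 : Real.exp (-(3 * Real.log p)) = 1 / (p : ℝ) ^ 3 := by
    rw [Real.exp_neg, show (3 : ℝ) * Real.log p = ((3 : ℕ) : ℝ) * Real.log p by norm_num,
      Real.exp_nat_mul, Real.exp_log hp', one_div]
  rw [h1, h2]
  refine le_of_eq ?_
  field_simp

end Asymptotics

/-! ### The good event and asymptotic normality of the entries -/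

section Main

lemma aemeasurable_debiased {n p : ℕ} {Ω : Type*} [MeasurableSpace Ω] {P : Measure Ω}
    {X : Fin n → Ω → Fin p → ℝ} {Θhat : Ω → Matrix (Fin p) (Fin p) ℝ}
    (hX : ∀ k, AEMeasurable (X k) P) (hΘ : ∀ i j, AEMeasurable (fun ω => Θhat ω i j) P)
    (i j : Fin p) :
    AEMeasurable (fun ω => debiased (sampleCov fun k => X k ω) (Θhat ω) i j) P := by
  have hS : ∀ i j, AEMeasurable (fun ω => sampleCov (fun k => X k ω) i j) P := fun i j => by
    simp only [sampleCov, of_apply]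
    refine (Finset.aemeasurable_fun_sum _ fun k _ => AEMeasurable.mul ?_ ?_).div_const _
    · exact (measurable_pi_apply i).comp_aemeasurable (hX k)
    · exact (measurable_pi_apply j).comp_aemeasurable (hX k)
  simp only [debiased, Matrix.sub_apply, Matrix.smul_apply, Matrix.mul_apply, smul_eq_mul]
  exact ((hΘ i j).const_mul 2).sub (Finset.aemeasurable_fun_sum _ fun k _ =>
    (Finset.aemeasurable_fun_sum _ fun l _ => (hΘ i l).mul (hS l k)).mul (hΘ k j))

variable {L K : ℝ} {p : ℕ → ℕ} {Ω : ℕ → Type*} [∀ n, MeasurableSpace (Ω n)]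
  {P : (n : ℕ) → Measure (Ω n)} [∀ n, IsProbabilityMeasure (P n)]
  {μ : (n : ℕ) → Measure (Fin (p n) → ℝ)} {X : (n : ℕ) → Fin n → Ω n → Fin (p n) → ℝ}
  {lam : ℕ → ℝ}

/-- With probability close to one the weighted graphical Lasso exists and the remainder of its
de-biased version is small. -/
lemma exists_good_event (hL : 1 ≤ L) (hK : 0 < K) (hp : ∀ n, 2 ≤ p n)
    (hμ : ∀ n, IsProbabilityMeasure (μ n)) (h0 : ∀ n i, ∫ x, x i ∂(μ n) = 0)
    (hind : ∀ n, iIndepFun (X n) (P n)) (hlaw : ∀ n k, HasLaw (X n k) (μ n) (P n))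
    (hspec : ∀ n, BoundedSpectrum (μ n) L) (hsub : ∀ n, SubGaussian (μ n) K)
    (hrate : Tendsto (fun n => max (sparsity (precMat (μ n)) : ℝ) 1 * √(Real.log (p n) / n))
      atTop (𝓝 0))
    (hlam1 : ∀ᶠ n : ℕ in atTop, 384 * L * K ^ 2 * √(Real.log (p n) / n) ≤ lam n)
    (hlam2 : lam =O[atTop] (fun n : ℕ => √(Real.log (p n) / n))) {e : ℝ} (he : 0 < e) :
    ∃ M : ℝ, 0 ≤ M ∧ ∀ᶠ n in atTop, ∃ E : Set (Ω n), P n Eᶜ ≤ ENNReal.ofReal e ∧ ∀ ω ∈ E,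
      (∃ Θ, IsWeightedGlasso (sampleCov fun k => X n k ω) (lam n) Θ) ∧
      ∀ Θh, IsWeightedGlasso (sampleCov fun k => X n k ω) (lam n) Θh → ∀ i j,
        |(debiased (sampleCov fun k => X n k ω) Θh - precMat (μ n) + precMat (μ n) *
          ((sampleCov fun k => X n k ω) - covMat (μ n)) * precMat (μ n)) i j| ≤
        M * (12 * (8 * L ^ 2) ^ 2 * max (sparsity (precMat (μ n)) : ℝ) 1 *
          √(maxDegree (precMat (μ n)) + 1 : ℝ) * lam n ^ 2) := by
  have hL0 : 0 < L := one_pos.trans_le hL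
  set r : ℕ → ℝ := fun n => √(Real.log (p n) / n) with hr
  set s : ℕ → ℝ := fun n => max (sparsity (precMat (μ n)) : ℝ) 1 with hs
  have hs1 : ∀ n, 1 ≤ s n := fun n => le_max_right _ _
  obtain ⟨T, hT0, hTnn, hT⟩ := exists_threshold (T₀ := 24 * K ^ 2) hK he
  obtain ⟨p₀, hp₀1, hp₀⟩ : ∃ p₀ : ℕ, 1 ≤ p₀ ∧ ∀ q : ℕ, p₀ ≤ q → 2 / (q : ℝ) ≤ e := by
    obtain ⟨N, hN⟩ := exists_nat_gt (2 / e)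
    refine ⟨N + 1, by omega, fun q hq => ?_⟩
    have hq' : (N : ℝ) + 1 ≤ q := by exact_mod_cast hq
    have hq0 : (0 : ℝ) < q := by linarith [Nat.cast_nonneg (α := ℝ) N]
    rw [div_le_iff₀ hq0]
    rw [div_lt_iff₀ he] at hN
    nlinarith
  obtain ⟨C, hC0, hC⟩ := hlam2.exists_pos
  -- The three summands enforce, in turn, the smallness condition of the oracle inequality, `τ ≤
  -- 1/(2L)`, and the range of Bernstein's inequality.
  set B := 64 * L ^ 3 * (C + T) * (p₀ : ℝ) ^ 2 + 2 * L * T + T / (48 * K ^ 2) with hB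
  have hB1 : 0 ≤ 64 * L ^ 3 * (C + T) * (p₀ : ℝ) ^ 2 := by positivity
  have hB2 : 0 ≤ 2 * L * T := by positivity
  have hB3 : 0 ≤ T / (48 * K ^ 2) := by positivity
  set c₀ := 384 * L * K ^ 2 with hc₀
  have hc₀0 : 0 < c₀ := by positivity
  refine ⟨500000 * L ^ 13 * (p₀ : ℝ) ^ 2 * (1 + T / c₀) ^ 2, by positivity, ?_⟩
  have hev : ∀ᶠ n in atTop, B * (s n * r n) ≤ 1 := by
    have : Tendsto (fun n => B * (s n * r n)) atTop (𝓝 (B * 0)) := hrate.const_mul B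
    rw [mul_zero] at this
    exact this.eventually_le_const one_pos
  filter_upwards [hev, hlam1, hC.bound, eventually_gt_atTop 0] with n hn1 hn2 hn3 hn0
  have hn' : (0 : ℝ) < n := Nat.cast_pos.2 hn0
  have hpn : (2 : ℝ) ≤ p n := by exact_mod_cast hp n
  have hlogp : 0 < Real.log (p n) := Real.log_pos (by linarith)
  have hr0 : 0 < r n := Real.sqrt_pos.2 (by positivity)
  have hr2 : r n ^ 2 = Real.log (p n) / n := Real.sq_sqrt (by positivity)
  have hlam0 : 0 < lam n := lt_of_lt_of_le (by positivity) hn2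
  rw [Real.norm_eq_abs, Real.norm_eq_abs, abs_of_pos hlam0, abs_of_pos hr0] at hn3
  have hBr : B * r n ≤ 1 := by
    refine le_trans ?_ hn1
    have : 0 ≤ B := by positivity
    exact mul_le_mul_of_nonneg_left (le_mul_of_one_le_left hr0.le (hs1 n)) this
  have hTr1 : T * r n ≤ 1 / (2 * L) := by
    rw [le_div_iff₀ (by positivity)]
    have h1 : B * r n = 64 * L ^ 3 * (C + T) * (p₀ : ℝ) ^ 2 * r n + T * r n * (2 * L) +
      T / (48 * K ^ 2) * r n := by rw [hB]; ring
    linarith [mul_nonneg hB1 hr0.le, mul_nonneg hB3 hr0.le]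
  have hTr2 : T * r n ≤ 48 * K ^ 2 := by
    have h1 : T / (48 * K ^ 2) * r n ≤ 1 := by
      have h1 : B * r n = 64 * L ^ 3 * (C + T) * (p₀ : ℝ) ^ 2 * r n + 2 * L * T * r n +
        T / (48 * K ^ 2) * r n := by rw [hB]; ring
      linarith [mul_nonneg hB1 hr0.le, mul_nonneg hB2 hr0.le]
    rwa [div_mul_eq_mul_div, div_le_one (by positivity)] at h1
  have hsmall : 64 * L ^ 3 * (lam n + T * r n) * ((p₀ : ℝ) ^ 2 * s n) ≤ 1 := by
    have hsr : 0 ≤ s n * r n := mul_nonneg (zero_le_one.trans (hs1 n)) hr0.le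
    have hs0 : 0 ≤ s n := zero_le_one.trans (hs1 n)
    calc _ ≤ 64 * L ^ 3 * (C * r n + T * r n) * ((p₀ : ℝ) ^ 2 * s n) := by gcongr
      _ = 64 * L ^ 3 * (C + T) * (p₀ : ℝ) ^ 2 * (s n * r n) := by ring
      _ ≤ B * (s n * r n) := by
          refine mul_le_mul_of_nonneg_right ?_ hsr
          rw [hB]; linarith
      _ ≤ 1 := hn1
  have hsp := (hspec n).spectralBounds hL
  have hp₀' : (1 : ℝ) ≤ (p₀ : ℝ) ^ 2 := one_le_pow₀ (by exact_mod_cast hp₀1)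
  -- For `p n ≥ p₀` the level `24K²` fails with probability at most `2/p ≤ e` and is dominated by
  -- the penalty. For `p n ≤ p₀` the larger level `T` is needed; the penalty may then be too weak,
  -- but the index set can be all pairs, of which there are at most `p₀²`.
  obtain ⟨U, hU0, hUT, hUP, hcase⟩ : ∃ U : ℝ, 0 ≤ U ∧ U ≤ T ∧
      (p n : ℝ) ^ 2 * (2 * Real.exp (-(U ^ 2 * Real.log (p n) / (192 * K ^ 4)))) ≤ e ∧
      (8 * L * (U * r n) ≤ lam n / 2 ∨ (p n : ℝ) ^ 2 ≤ (p₀ : ℝ) ^ 2 * s n) := by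
    rcases le_total p₀ (p n) with h | h
    · refine ⟨24 * K ^ 2, by positivity, hT0, (union_bound_le hK (hp n)).trans (hp₀ _ h), Or.inl ?_⟩
      rw [hc₀] at hn2
      linarith
    · refine ⟨T, hTnn, le_rfl, hT _ (hp n), Or.inr ?_⟩
      have h1 : (p n : ℝ) ^ 2 ≤ (p₀ : ℝ) ^ 2 := by gcongr
      exact h1.trans (le_mul_of_one_le_right (by positivity) (hs1 n))
  have hUr : U * r n ≤ T * r n := mul_le_mul_of_nonneg_right hUT hr0.le
  have hUr0 : 0 ≤ U * r n := mul_nonneg hU0 hr0.le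
  refine ⟨{ω | ∃ i j, U * r n <
    |sampleCov (fun k => X n k ω) i j - covMat (μ n) i j|}ᶜ, ?_, fun ω hω => ?_⟩
  · rw [compl_compl]
    have := hμ n
    refine (measure_exists_lt_abs_le hK (h0 n) (hsub n) hn0 (hind n) (hlaw n) hUr0
      (hUr.trans hTr2)).trans (ENNReal.ofReal_le_ofReal ?_)
    have e1 : (n : ℝ) * (U * r n) ^ 2 = U ^ 2 * Real.log (p n) := by
      rw [mul_pow, hr2]; field_simp
    rw [e1]
    exact hUP
  have hτ : ∀ i j, |sampleCov (fun k => X n k ω) i j - covMat (μ n) i j| ≤ U * r n := by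
    simpa using hω
  refine ⟨exists_isWeightedGlasso_of_close hL hsp (sampleCov_posSemidef _) hτ (hUr.trans hTr1)
    hlam0, fun Θh hΘh i j => ?_⟩
  have hs0 : 0 ≤ s n := zero_le_one.trans (hs1 n)
  have hmain := abs_remainder_le_of_sparsity hL hsp hτ hUr0 (hUr.trans hTr1) hlam0 hcase
    (le_mul_of_one_le_left hs0 hp₀') (le_trans (by gcongr) hsmall) hΘh i j
  refine hmain.trans ?_
  -- The lower bound on `lam` turns the noise level into a multiple of `lam`.
  have hlr : lam n + U * r n ≤ (1 + T / c₀) * lam n := by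
    have h1 : T * r n ≤ T / c₀ * lam n := by
      rw [div_mul_eq_mul_div, le_div_iff₀ hc₀0]
      calc T * r n * c₀ = T * (c₀ * r n) := by ring
        _ ≤ T * lam n := mul_le_mul_of_nonneg_left hn2 hTnn
    linarith
  -- The explicit constant in the rate is at least 1 and can be inserted for free.
  have hL8 : 1 ≤ 12 * (8 * L ^ 2) ^ 2 := by
    have : 1 ≤ L ^ 2 := one_le_pow₀ hL
    nlinarith
  calc _ ≤ 500000 * L ^ 13 * ((p₀ : ℝ) ^ 2 * s n) * √(maxDegree (precMat (μ n)) + 1 : ℝ) *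
        ((1 + T / c₀) * lam n) ^ 2 := by gcongr
    _ = 500000 * L ^ 13 * (p₀ : ℝ) ^ 2 * (1 + T / c₀) ^ 2 *
        (1 * (s n * √(maxDegree (precMat (μ n)) + 1 : ℝ) * lam n ^ 2)) := by ring
    _ ≤ 500000 * L ^ 13 * (p₀ : ℝ) ^ 2 * (1 + T / c₀) ^ 2 * (12 * (8 * L ^ 2) ^ 2 *
        (s n * √(maxDegree (precMat (μ n)) + 1 : ℝ) * lam n ^ 2)) := by gcongr
    _ = _ := by ring

/-- Asymptotic normality of an entry of the de-biased estimator, from a negligible remainder. -/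
lemma tendstoInDistribution_entry (hL : 1 ≤ L) (hK : 0 < K)
    (hμ : ∀ n, IsProbabilityMeasure (μ n)) (h0 : ∀ n i, ∫ x, x i ∂(μ n) = 0)
    (hind : ∀ n, iIndepFun (X n) (P n)) (hlaw : ∀ n k, HasLaw (X n k) (μ n) (P n))
    (hspec : ∀ n, BoundedSpectrum (μ n) L) (hsub : ∀ n, SubGaussian (μ n) K)
    {Θhat : (n : ℕ) → Ω n → Matrix (Fin (p n)) (Fin (p n)) ℝ}
    (hΘ : ∀ n i j, AEMeasurable (fun ω => Θhat n ω i j) (P n))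
    (hrem : IsLittleOP P (fun n ω => supNorm (debiased (sampleCov fun k => X n k ω) (Θhat n ω) -
      precMat (μ n) + precMat (μ n) * ((sampleCov fun k => X n k ω) - covMat (μ n)) *
        precMat (μ n))) fun n => 1 / √(n : ℝ))
    (i j : (n : ℕ) → Fin (p n)) {c : ℝ} (hc : 0 < c)
    (hσ : ∀ᶠ n in atTop, c ≤ asympSD (P n) (μ n) (X n) (i n) (j n)) :
    TendstoInDistribution
      (fun (n : ℕ) ω => √(n : ℝ) * (debiased (sampleCov fun k => X n k ω) (Θhat n ω) -
        precMat (μ n)) (i n) (j n) / asympSD (P n) (μ n) (X n) (i n) (j n))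
      atTop id P (gaussianReal 0 1) := by
  have hL0 : 0 < L := one_pos.trans_le hL
  have hsp := fun n => (hspec n).spectralBounds hL
  set σ : ℕ → ℝ := fun n => asympSD (P n) (μ n) (X n) (i n) (j n) with hσdef
  set a : (n : ℕ) → Fin (p n) → ℝ := fun n k => precMat (μ n) k (i n) with ha
  set b : (n : ℕ) → Fin (p n) → ℝ := fun n k => precMat (μ n) k (j n) with hb
  set Z : (n : ℕ) → (Fin (p n) → ℝ) → ℝ := fun n x => (a n ⬝ᵥ x) * (b n ⬝ᵥ x) with hZ
  have hZm : ∀ n, Measurable (Z n) := fun n =>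
    (by simp only [hZ]; fun_prop : Continuous (Z n)).measurable
  have hcol : ∀ n (l : Fin (p n)),
      0 < (fun k => precMat (μ n) k l) ⬝ᵥ (fun k => precMat (μ n) k l) ∧
      (fun k => precMat (μ n) k l) ⬝ᵥ (fun k => precMat (μ n) k l) ≤ L ^ 2 := fun n l => by
    have e : (fun k => precMat (μ n) k l) ⬝ᵥ (fun k => precMat (μ n) k l) =
        ∑ k, precMat (μ n) k l ^ 2 := by simp [dotProduct, sq]
    rw [e]
    refine ⟨?_, (hsp n).col_le l⟩
    have h1 : 0 < precMat (μ n) l l := (hsp n).posDef.diag_pos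
    exact lt_of_lt_of_le (by positivity) (Finset.single_le_sum
      (f := fun k => precMat (μ n) k l ^ 2) (fun _ _ => sq_nonneg _) (Finset.mem_univ l))
  set κ := L ^ 2 * K ^ 2 with hκ
  have hκ0 : 0 < κ := by positivity
  have hZs : ∀ n, SubExp (Z n) κ (μ n) := fun n =>
    (hsub n).subExp_bilin hK (hcol n _).1 (hcol n _).2 (hcol n _).1 (hcol n _).2
  have hσ_eq : ∀ n, 0 < n → σ n = √(Var[Z n; μ n]) := fun n hn =>
    asympSD_eq hn (hind n) (hlaw n) (i n) (j n) ((hZs n).memLp_two hκ0)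
  set E : ℕ → ℝ := fun n => ∫ x, Z n x ∂(μ n) with hE
  -- The minus sign is that of the linear term `-Θ(S - C)Θ`.
  set g : (n : ℕ) → (Fin (p n) → ℝ) → ℝ := fun n x => -(Z n x - E n) / σ n with hg
  have hgm : ∀ n, Measurable (g n) := fun n => (((hZm n).sub_const _).neg).div_const _
  have hν : ∀ n, IsProbabilityMeasure ((μ n).map (g n)) := fun n =>
    Measure.isProbabilityMeasure_map (hgm n).aemeasurable
  have hint : ∀ n, Integrable (Z n) (μ n) := fun n => (hZs n).integrable hκ0
  refine tendstoInDistribution_triangular (Y := fun n k ω => g n (X n k ω))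
    (ν := fun n => (μ n).map (g n)) (M := 36 * κ ^ 3 / c ^ 3) (fun n => ?_)
    (fun n => (hind n).comp (fun _ => g n) fun _ => hgm n)
    (fun n k => HasLaw.comp_measurable (hlaw n k) (hgm n)) (Eventually.of_forall fun n => ?_)
    ?_ (Eventually.of_forall fun n => ?_) ?_ fun e he => ?_
  · simp only [Matrix.sub_apply]
    exact (((aemeasurable_debiased (fun k => (hlaw n k).aemeasurable) (hΘ n) _ _).sub_const
      _).const_mul _).div_const _
  · rw [integral_map (hgm n).aemeasurable (by fun_prop)]
    have : ∫ x, (Z n x - E n) ∂(μ n) = 0 := by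
      rw [integral_sub (hint n) (integrable_const _)]; simp [hE]
    simp only [hg]
    rw [integral_div, integral_neg, this]
    simp
  · filter_upwards [hσ, eventually_gt_atTop 0] with n h1 hn
    have hσ0 : 0 < σ n := hc.trans_le h1
    have hv : ∫ x, (Z n x - E n) ^ 2 ∂(μ n) = σ n ^ 2 := by
      rw [hσ_eq n hn, Real.sq_sqrt (variance_nonneg _ _),
        variance_eq_integral (hZm n).aemeasurable]
    rw [integral_map (hgm n).aemeasurable (by fun_prop)]
    simp only [hg, div_pow, neg_sq]
    rw [integral_div, hv, div_self (by positivity)]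
  · have h3 := ((hZs n).integral_abs_pow_three_le hκ0).1
    rw [integrable_map_measure (by fun_prop) (hgm n).aemeasurable]
    refine (h3.div_const (|σ n| ^ 3)).congr (Eventually.of_forall fun x => ?_)
    simp only [hg, Function.comp_apply, abs_div, abs_neg, div_pow, hE]
  · filter_upwards [hσ] with n h1
    have hσ0 : 0 < σ n := hc.trans_le h1
    have h3 := ((hZs n).integral_abs_pow_three_le hκ0).2
    rw [integral_map (hgm n).aemeasurable (by fun_prop)]
    simp only [hg, abs_div, abs_neg, div_pow]
    rw [integral_div, abs_of_pos hσ0]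
    have : c ^ 3 ≤ σ n ^ 3 := by gcongr
    exact div_le_div₀ (by positivity) h3 (by positivity) this
  · refine tendsto_zero_of_eventually_le_ofReal fun δ hδ => ?_
    -- After division by `σ ≥ c`, a deviation above `e` forces the remainder above `e c / √n`.
    have h5 := ENNReal.tendsto_nhds_zero.1 (hrem (e * c) (by positivity)) (ENNReal.ofReal δ)
      (ENNReal.ofReal_pos.2 hδ)
    filter_upwards [h5, hσ, eventually_gt_atTop 0] with n h6 h1 hn
    have hσ0 : 0 < σ n := hc.trans_le h1
    have hn' : (0 : ℝ) < n := Nat.cast_pos.2 hn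
    have hsq : 0 < √(n : ℝ) := Real.sqrt_pos.2 hn'
    refine (measure_mono fun ω hω => ?_).trans h6
    simp only [Set.mem_ofPred_eq] at hω ⊢
    set S := sampleCov fun k => X n k ω with hS
    set Θ := precMat (μ n) with hΘdef
    set R := debiased S (Θhat n ω) - Θ + Θ * (S - covMat (μ n)) * Θ with hR
    have hsym : ∀ k l, Θ k l = Θ l k := fun k l => by
      have := congrFun (congrFun (hsp n).posDef.1 l) k
      simpa [conjTranspose_eq_transpose_of_trivial] using this
    have hquad : (Θ * (S - covMat (μ n)) * Θ) (i n) (j n) = (∑ k, (Z n (X n k ω) - E n)) / n := by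
      have e1 : (Θ * (S - covMat (μ n)) * Θ) (i n) (j n) =
          a n ⬝ᵥ (S *ᵥ b n) - a n ⬝ᵥ (covMat (μ n) *ᵥ b n) := by
        rw [← dotProduct_sub, ← Matrix.sub_mulVec, Matrix.mul_assoc, Matrix.mul_apply]
        simp only [dotProduct, mulVec, Matrix.mul_apply, ha, hb]
        exact Finset.sum_congr rfl fun k _ => by rw [hsym]
      have := hμ n
      rw [e1, hS, dotProduct_sampleCov_mulVec, dotProduct_covMat_mulVec hK (h0 n) (hsub n),
        Finset.sum_sub_distrib]
      simp only [Finset.sum_const, Finset.card_univ, Fintype.card_fin, nsmul_eq_mul, hZ, hE]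
      field_simp
    have hsum : ∑ k, g n (X n k ω) = -(∑ k, (Z n (X n k ω) - E n)) / σ n := by
      simp only [hg]
      rw [← Finset.sum_div, Finset.sum_neg_distrib]
    have hRe : (debiased S (Θhat n ω) - Θ) (i n) (j n) =
        R (i n) (j n) - (∑ k, (Z n (X n k ω) - E n)) / n := by
      rw [← hquad, hR, Matrix.add_apply]; ring
    have hdiff : √(n : ℝ) * (debiased S (Θhat n ω) - Θ) (i n) (j n) / σ n -
        (√(n : ℝ))⁻¹ * ∑ k, g n (X n k ω) = √(n : ℝ) * R (i n) (j n) / σ n := by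
      rw [hRe, hsum]
      have h7 : (√(n : ℝ))⁻¹ = √(n : ℝ) / n := by
        rw [inv_eq_one_div, div_eq_div_iff hsq.ne' hn'.ne', one_mul, Real.mul_self_sqrt hn'.le]
      rw [h7]
      field_simp
      ring
    rw [hdiff, abs_div, abs_mul, abs_of_pos hσ0, abs_of_pos hsq, lt_div_iff₀ hσ0] at hω
    have h8 := abs_apply_le_supNorm R (i n) (j n)
    refine lt_of_lt_of_le ?_ (le_abs_self _)
    refine lt_of_lt_of_le ?_ h8
    rw [mul_one_div, div_lt_iff₀ hsq, mul_comm (|R _ _|)]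
    exact lt_of_le_of_lt (mul_le_mul_of_nonneg_left h1 he.le) hω

end Main

end WGlasso
end

theorem mainTheorem3 (L K : ℝ) (hL : 1 ≤ L) (hK : 0 < K) :
    ∃ c₀ : ℝ, 0 < c₀ ∧
      ∀ (p : ℕ → ℕ) (Ω : ℕ → Type*) [∀ n, MeasurableSpace (Ω n)]
        (P : (n : ℕ) → Measure (Ω n)) [∀ n, IsProbabilityMeasure (P n)]
        (μ : (n : ℕ) → Measure (Fin (p n) → ℝ))
        (X : (n : ℕ) → Fin n → Ω n → Fin (p n) → ℝ)
        (lam : ℕ → ℝ)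
        (Θhat : (n : ℕ) → Ω n → Matrix (Fin (p n)) (Fin (p n)) ℝ),
        (∀ n, 2 ≤ p n) →
        -- the rows of the array are i.i.d. samples from the centred distribution `μ n`
        (∀ n, IsProbabilityMeasure (μ n)) →
        (∀ n i, ∫ x, x i ∂(μ n) = 0) →
        (∀ n, iIndepFun (X n) (P n)) →
        (∀ n k, HasLaw (X n k) (μ n) (P n)) →
        -- bounded spectrum and sub-Gaussianity
        (∀ n, WGlasso.BoundedSpectrum (μ n) L) →
        (∀ n, WGlasso.SubGaussian (μ n) K) →
        -- sparsity
        (fun n => (max (WGlasso.sparsity (WGlasso.precMat (μ n))) 1 : ℝ)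
            * √(max (WGlasso.maxDegree (WGlasso.precMat (μ n))) 1 : ℝ))
          =o[atTop] (fun n : ℕ => √(n : ℝ) / Real.log (p n)) →
        -- tuning parameter of the exact order `√(log p / n)`, with large enough lower constant
        (∀ᶠ n : ℕ in atTop, c₀ * √(Real.log (p n) / n) ≤ lam n) →
        lam =O[atTop] (fun n : ℕ => √(Real.log (p n) / n)) →
        -- `Θhat` is a measurable version of the weighted graphical Lasso
        (∀ n i j, AEMeasurable (fun ω => Θhat n ω i j) (P n)) →
        (∀ n, ∀ᵐ ω ∂(P n),
          (∃ Θ, WGlasso.IsWeightedGlasso (WGlasso.sampleCov fun k => X n k ω) (lam n) Θ) →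
            WGlasso.IsWeightedGlasso (WGlasso.sampleCov fun k => X n k ω) (lam n) (Θhat n ω)) →
        -- the weighted graphical Lasso exists with probability tending to one
        Tendsto (fun n => P n {ω |
            ¬ ∃ Θ, WGlasso.IsWeightedGlasso (WGlasso.sampleCov fun k => X n k ω) (lam n) Θ})
          atTop (𝓝 0) ∧
        -- asymptotic linearity
        (∃ rem : (n : ℕ) → Ω n → Matrix (Fin (p n)) (Fin (p n)) ℝ,
          (∀ n ω, WGlasso.debiased (WGlasso.sampleCov fun k => X n k ω) (Θhat n ω)
              - WGlasso.precMat (μ n)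
            = -(WGlasso.precMat (μ n)
                * ((WGlasso.sampleCov fun k => X n k ω) - WGlasso.covMat (μ n))
                * WGlasso.precMat (μ n)) + rem n ω) ∧
          WGlasso.IsBigOP P (fun n ω => WGlasso.supNorm (rem n ω))
            (fun n => 12 * (8 * L ^ 2) ^ 2
              * (max (WGlasso.sparsity (WGlasso.precMat (μ n))) 1 : ℝ)
              * √(WGlasso.maxDegree (WGlasso.precMat (μ n)) + 1 : ℝ) * lam n ^ 2) ∧
          WGlasso.IsLittleOP P (fun n ω => WGlasso.supNorm (rem n ω))
            (fun n => 1 / √(n : ℝ))) ∧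
        -- asymptotic normality of the entries
        ∀ i j : (n : ℕ) → Fin (p n),
          (∃ c : ℝ, 0 < c ∧ ∀ᶠ n in atTop,
            c ≤ WGlasso.asympSD (P n) (μ n) (X n) (i n) (j n)) →
          TendstoInDistribution
            (fun (n : ℕ) ω => √(n : ℝ)
              * (WGlasso.debiased (WGlasso.sampleCov fun k => X n k ω) (Θhat n ω)
                  - WGlasso.precMat (μ n)) (i n) (j n)
              / WGlasso.asympSD (P n) (μ n) (X n) (i n) (j n))
            atTop id P (gaussianReal 0 1) := by

  -- `384 = 2 * 8 * 24`: the normalized noise is `8L` times the level `24K²√(log p / n)`, and the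
  -- penalty has to be twice as large.
  refine ⟨384 * L * K ^ 2, by positivity, ?_⟩
  intro p Ω _ P _ μ X lam Θhat hp hμ h0 hind hlaw hspec hsub hsparse hlam1 hlam2 hΘm hΘ
  have hp' : ∀ n, (2 : ℝ) ≤ p n := fun n => by exact_mod_cast hp n
  have hlog : ∀ n, Real.log 2 ≤ Real.log (p n) := fun n =>
    Real.log_le_log (by norm_num) (hp' n)
  have hlog2 : 0 < Real.log 2 := Real.log_pos (by norm_num)
  have hrate := WGlasso.tendsto_sparsity_mul_rate hlog2 (fun n => le_max_right _ _)
    (fun n => le_max_right _ _) hlog hsparse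
  have hgood := fun (e : ℝ) (he : 0 < e) => WGlasso.exists_good_event hL hK hp hμ h0 hind hlaw
    hspec hsub hrate hlam1 hlam2 he
  have hbig : WGlasso.IsBigOP P (fun n ω => WGlasso.supNorm
      (WGlasso.debiased (WGlasso.sampleCov fun k => X n k ω) (Θhat n ω) - WGlasso.precMat (μ n) +
        WGlasso.precMat (μ n) * ((WGlasso.sampleCov fun k => X n k ω) - WGlasso.covMat (μ n)) *
          WGlasso.precMat (μ n)))
      (fun n => 12 * (8 * L ^ 2) ^ 2
        * (max (WGlasso.sparsity (WGlasso.precMat (μ n))) 1 : ℝ)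
        * √(WGlasso.maxDegree (WGlasso.precMat (μ n)) + 1 : ℝ) * lam n ^ 2) := by
    intro e he
    obtain ⟨M, hM0, hM⟩ := hgood e he
    refine ⟨M, ?_⟩
    filter_upwards [hM] with n hn
    obtain ⟨E, hE, hEω⟩ := hn
    -- `Θhat` is a minimizer only almost surely on the good event, so the inclusion of events holds
    -- up to a null set.
    refine le_trans (measure_mono_ae ?_) hE
    filter_upwards [hΘ n] with ω hω hlt hωE
    have h1 := hEω ω hωE
    exact absurd (WGlasso.abs_supNorm_le (by positivity) (h1.2 _ (hω h1.1))) (not_le.2 hlt)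
  have hlittle := hbig.isLittleOP (WGlasso.isLittleO_remainder_rate
    (d' := fun n => (WGlasso.maxDegree (WGlasso.precMat (μ n)) + 1 : ℝ))
    (fun n => le_max_right _ _) (fun n => hlog2.trans_le (hlog n)) (fun n => by
      have h1 := le_max_left (WGlasso.maxDegree (WGlasso.precMat (μ n)) : ℝ) 1
      have h2 := le_max_right (WGlasso.maxDegree (WGlasso.precMat (μ n)) : ℝ) 1
      linarith) hsparse hlam2 (12 * (8 * L ^ 2) ^ 2)) (Eventually.of_forall fun n => by positivity)
  -- The remainder is whatever the expansion leaves, also where no minimizer exists, and is read off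
  -- from `hbig`.
  refine ⟨?_, ⟨_, fun n ω => ?_, hbig, hlittle⟩, ?_⟩
  · refine WGlasso.tendsto_zero_of_eventually_le_ofReal fun e he => ?_
    obtain ⟨M, hM0, hM⟩ := hgood e he
    filter_upwards [hM] with n hn
    obtain ⟨E, hE, hEω⟩ := hn
    refine (measure_mono fun ω hω => ?_).trans hE
    exact fun hωE => hω (hEω ω hωE).1
  · abel
  · rintro i j ⟨c, hc, hσ⟩
    exact WGlasso.tendstoInDistribution_entry hL hK hμ h0 hind hlaw hspec hsub hΘm hlittle i j hc hσ
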